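/- Let $b,\tau>0$, $\Omega=(-b,b)\times(0,\tau)$, and let $q\in C[-b,b]$ be complex valued. Let $f\in C[-b,b]$ be a complex-valued solution of $f''-q(x)f=0$ on $(-b,b)$ with $f(0)=1$ and $f(x)\neq 0$ for all $x\in[-b,b]$. Put $X^{(0)}\equiv\tilde X^{(0)}\equiv 1$ and, for $n\ge 1$ and $x\in[-b,b]$, $$X^{(n)}(x)=n\int_0^x X^{(n-1)}(s)\,\bigl(f^2(s)\bigr)^{(-1)^n}ds,\qquad \tilde X^{(n)}(x)=n\int_0^x \tilde X^{(n-1)}(s)\,\bigl(f^2(s)\bigr)^{(-1)^{n-1}}ds .$$ Let $\varphi_k=fX^{(k)}$ for odd $k$ and $\varphi_k=f\tilde X^{(k)}$ for even $k$ (the formal powers), and define for $n\ge 0$ the transmuted heat polynomials and the heat polynomials $$u_n(x,t)=n!\sum_{k=0}^{[n/2]}\frac{t^k\varphi_{n-2k}(x)}{k!\,(n-2k)!},\qquad h_n(x,t)=n!\sum_{k=0}^{[n/2]}\frac{t^kx^{n-2k}}{k!\,(n-2k)!}.$$ (i) $u_n=Th_n$ (with $T$ acting in $x$) on $[-b,b]\times\mathbb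 R$ for every $n\ge 0$ and every transmutation operator $Tv(x)=v(x)+\int_{-x}^xK(x,s)v(s)\,ds$ with $T[1]=f$ on $[-b,b]$, that is, for every kernel $K$, continuous on $|s|\le|x|\le b$, such that for each $v\in C^2[-b,b]$ the function $Tv$ is twice differentiable on $(-b,b)$ and $(Tv)''-q\,Tv=T(v'')$ there. (ii) Let $u$ be a complex-valued function that is continuous on $\overline\Omega=[-b,b]\times[0,\tau]$ and satisfies $u_{xx}-q(x)u=u_t$ at every point of $\Omega$ (the derivatives that occur being assumed to exist there). Then for every $\varepsilon>0$ there are $N\in\mathbb N$ and constants $a_0,\dots,a_N\in\mathbb C$ such that $$\max_{(x,t)\in\overline\Omega}\Bigl|u(x,t)-\sum_{n=0}^Na_nu_n(x,t)\Bigr|<\varepsilon .$$ -/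

import Mathlib

/-- `u` satisfies `u_xx - q(x) u = u_t` at every point of `(-b,b) × (0,τ)`: the partial derivatives
that occur in the equation exist there, and the equation holds. -/
def IsSolution (b τ : ℝ) (q : ℝ → ℂ) (u : ℝ → ℝ → ℂ) : Prop :=
  ∀ x ∈ Set.Ioo (-b) b, ∀ t ∈ Set.Ioo 0 τ,
    DifferentiableAt ℝ (fun y => u y t) x ∧
    DifferentiableAt ℝ (deriv (fun y => u y t)) x ∧
    DifferentiableAt ℝ (fun s => u x s) t ∧
    deriv (deriv (fun y => u y t)) x - q x * u x t = deriv (fun s => u x s) t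

/-- `f` is a solution of `f'' - q f = 0` on `(-b,b)`, continuous up to the end points, without zeros
on `[-b,b]`, and normalized by `f 0 = 1`. -/
structure IsNonvanishingSolution (b : ℝ) (q f : ℝ → ℂ) : Prop where
  continuousOn : ContinuousOn f (Set.Icc (-b) b)
  differentiableAt : ∀ x ∈ Set.Ioo (-b) b, DifferentiableAt ℝ f x
  differentiableAt_deriv : ∀ x ∈ Set.Ioo (-b) b, DifferentiableAt ℝ (deriv f) x
  equation : ∀ x ∈ Set.Ioo (-b) b, deriv (deriv f) x - q x * f x = 0
  ne_zero : ∀ x ∈ Set.Icc (-b) b, f x ≠ 0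
  map_zero : f 0 = 1

/-- The recurrent integrals `X^(n)`:
`X^(0) = 1` and `X^(n)(x) = n ∫_0^x X^(n-1)(s) (f(s)^2)^((-1)^n) ds`. -/
noncomputable def recX (f : ℝ → ℂ) : ℕ → ℝ → ℂ
  | 0 => fun _ => 1
  | n + 1 => fun x => ((n + 1 : ℕ) : ℂ) * ∫ s in (0 : ℝ)..x, recX f n s * (f s ^ 2) ^ ((-1 : ℤ) ^ (n + 1))

/-- The recurrent integrals `X̃^(n)`:
`X̃^(0) = 1` and `X̃^(n)(x) = n ∫_0^x X̃^(n-1)(s) (f(s)^2)^((-1)^(n-1)) ds`. -/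
noncomputable def recXTilde (f : ℝ → ℂ) : ℕ → ℝ → ℂ
  | 0 => fun _ => 1
  | n + 1 => fun x => ((n + 1 : ℕ) : ℂ) * ∫ s in (0 : ℝ)..x, recXTilde f n s * (f s ^ 2) ^ ((-1 : ℤ) ^ n)

/-- The formal powers `φ_k` associated with `f`. -/
noncomputable def formalPower (f : ℝ → ℂ) (k : ℕ) (x : ℝ) : ℂ :=
  if Odd k then f x * recX f k x else f x * recXTilde f k x

/-- The heat polynomials `h_n`. -/
noncomputable def heatPoly (n : ℕ) (x t : ℝ) : ℂ :=
  (n.factorial : ℂ) * ∑ k ∈ Finset.range (n / 2 + 1),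
    (t : ℂ) ^ k * (x : ℂ) ^ (n - 2 * k) / ((k.factorial : ℂ) * ((n - 2 * k).factorial : ℂ))

/-- The transmuted heat polynomials `u_n`, written through the formal powers. -/
noncomputable def transmutedHeatPoly (f : ℝ → ℂ) (n : ℕ) (x t : ℝ) : ℂ :=
  (n.factorial : ℂ) * ∑ k ∈ Finset.range (n / 2 + 1),
    (t : ℂ) ^ k * formalPower f (n - 2 * k) x / ((k.factorial : ℂ) * ((n - 2 * k).factorial : ℂ))

/-- The Volterra operator `T v (x) = v x + ∫_{-x}^x K(x,s) v(s) ds`. -/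
noncomputable def volterra (K : ℝ → ℝ → ℂ) (v : ℝ → ℂ) (x : ℝ) : ℂ :=
  v x + ∫ s in (-x)..x, K x s * v s

/-- The Volterra operator `T` with kernel `K` is a transmutation operator for `A = d²/dx² - q` and
`B = d²/dx²` with `T[1] = f`: for each `v` of class `C²`, `A T v = T B v` on `(-b,b)`. Of the kernel
only continuity on `|s| ≤ |x| ≤ b` is asked, so that every continuously differentiable one is covered;
a function of class `C²` on `[-b,b]` is the restriction of one of class `C²` on `ℝ`. -/
structure IsTransmutationKernel (b : ℝ) (q f : ℝ → ℂ) (K : ℝ → ℝ → ℂ) : Prop where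
  continuousOn : ContinuousOn (fun p : ℝ × ℝ => K p.1 p.2) {p | |p.2| ≤ |p.1| ∧ |p.1| ≤ b}
  intertwines : ∀ v : ℝ → ℂ, ContDiff ℝ 2 v → ∀ x ∈ Set.Ioo (-b) b,
    DifferentiableAt ℝ (volterra K v) x ∧
    DifferentiableAt ℝ (deriv (volterra K v)) x ∧
    deriv (deriv (volterra K v)) x - q x * volterra K v x = volterra K (deriv (deriv v)) x
  map_one : ∀ x ∈ Set.Icc (-b) b, volterra K (fun _ => 1) x = f x

/-!
The proof rests on the operator `R`, the right inverse of `d²/dx² - q` with zero Cauchy data at `0`.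
Since `f` has no zeros, the Pólya factorization `f (y'' - q y) = (f² (y / f)')'` gives `R` explicitly
(`cauchySol`, `cauchyInv`), and the recurrent integrals say that `φ_{k+2} = (k + 2) (k + 1) R φ_k`
(`formalPower_add_two`). The same factorization shows that a solution of `h'' - q h = g` is determined
by its Cauchy data at `0` (`IsNonvanishingSolution.eq_cauchySol`).

*Transmutation.* `T[x^k]` and `φ_k` both solve `h'' - q h = k (k - 1) φ_{k-2}`, with equal Cauchy data
at `0`, so they agree on `[-b, b]` (`IsTransmutationKernel.volterra_pow`); the heat polynomials follow
by linearity.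

*Approximation.* A maximum principle for complex-valued functions, which needs no more than the
pointwise existence of the derivatives in the equation, bounds a solution of `v_xx - q v = v_t`
through its values on the parabolic boundary (`norm_le_of_parabolic`). So it suffices to approximate
the boundary values of `u` by those of the `u_n`. By the Hahn–Banach theorem this is a statement about
functionals `(L₀, L₁, L₂)` on the bottom and the two lateral sides that annihilate all `u_n`. In terms
of the solutions `y = (1 - l R)⁻¹ p` of `y'' - (q + l) y = 0`, where `p'' - q p = 0`, annihilation
means `L₀ y + A l * y b + B l * y (-b) = 0` for all complex `l`, where `A l = L₁ (exp (l t))` and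
`B l = L₂ (exp (l t))` are entire. For large `Re l` the maximum principle `norm_le_of_elliptic` allows
choosing `y` with `y b = 1`, `y (-b) = 0` and `|y| ≤ 1`, so `A` is bounded there; elsewhere it is
bounded because `exp (l t)` is. By Liouville's theorem `A` and `B` are constant, which places `L₁` and
`L₂` at the corners (`IsNonvanishingSolution.boundary_dual_eq_zero`). What remains is the completeness
of the formal powers in `C[-b, b]` (`IsNonvanishingSolution.dual_eq_zero`), which follows from a
similar argument for the entire function `L ((1 - l R)⁻¹ R g)`; this one has order at most `1/2`, so the
Phragmén–Lindelöf principle carries its bound from a right half-plane to the whole plane.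
-/

/-! ### Second derivatives and maximum principles -/

/-- `w` is differentiable near `x`, and `d` is its second derivative at `x`. -/
def HasSecondDerivAt (w : ℝ → ℂ) (d : ℂ) (x : ℝ) : Prop :=
  ∃ w' : ℝ → ℂ, (∀ᶠ y in nhds x, HasDerivAt w (w' y) y) ∧ HasDerivAt w' d x

namespace HasSecondDerivAt

variable {v w : ℝ → ℂ} {d e : ℂ} {x : ℝ}

theorem congr_of_eventuallyEq (h : HasSecondDerivAt w d x) (hvw : v =ᶠ[nhds x] w) :
    HasSecondDerivAt v d x := by
  obtain ⟨w', h1, h2⟩ := h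
  refine ⟨w', ?_, h2⟩
  filter_upwards [h1, hvw.eventuallyEq_nhds] with y hy hy2
  exact hy.congr_of_eventuallyEq hy2

theorem add (hv : HasSecondDerivAt v d x) (hw : HasSecondDerivAt w e x) :
    HasSecondDerivAt (fun y => v y + w y) (d + e) x := by
  obtain ⟨v', h1, h2⟩ := hv
  obtain ⟨w', h3, h4⟩ := hw
  refine ⟨fun y => v' y + w' y, ?_, h2.add h4⟩
  filter_upwards [h1, h3] with y hy hy2
  exact hy.add hy2

theorem const_mul (c : ℂ) (hv : HasSecondDerivAt v d x) :
    HasSecondDerivAt (fun y => c * v y) (c * d) x := by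
  obtain ⟨v', h1, h2⟩ := hv
  refine ⟨fun y => c * v' y, ?_, h2.const_mul c⟩
  filter_upwards [h1] with y hy
  exact hy.const_mul c

theorem sub (hv : HasSecondDerivAt v d x) (hw : HasSecondDerivAt w e x) :
    HasSecondDerivAt (fun y => v y - w y) (d - e) x := by
  have := hv.add (hw.const_mul (-1))
  simpa [sub_eq_add_neg] using this

theorem sum {ι : Type*} (s : Finset ι) {v : ι → ℝ → ℂ} {d : ι → ℂ}
    (h : ∀ i ∈ s, HasSecondDerivAt (v i) (d i) x) :
    HasSecondDerivAt (fun y => ∑ i ∈ s, v i y) (∑ i ∈ s, d i) x := by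
  classical
  induction s using Finset.induction_on with
  | empty =>
    simpa using! (⟨fun _ => 0, .of_forall fun y => hasDerivAt_const y (0 : ℂ), hasDerivAt_const x 0⟩ :
      HasSecondDerivAt (fun _ => 0) 0 x)
  | insert i s hi ih =>
    simp only [Finset.sum_insert hi]
    exact (h i (Finset.mem_insert_self i s)).add
      (ih fun j hj => h j (Finset.mem_insert_of_mem hj))

theorem of_deriv (h1 : ∀ᶠ y in nhds x, DifferentiableAt ℝ v y)
    (h2 : DifferentiableAt ℝ (deriv v) x) : HasSecondDerivAt v (deriv (deriv v) x) x :=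
  ⟨deriv v, h1.mono fun _ hy => hy.hasDerivAt, h2.hasDerivAt⟩

/-- The second-order condition at a local maximum of the modulus of a complex-valued function: it is
the real condition for `Re (conj (w x) * w)`, which has a local maximum at `x` as well. -/
theorem re_conj_mul_nonpos (hw : HasSecondDerivAt w d x) (hmax : ∀ᶠ y in nhds x, ‖w y‖ ≤ ‖w x‖) :
    (starRingEnd ℂ (w x) * d).re ≤ 0 := by
  obtain ⟨w', h1, h2⟩ := hw
  set c := starRingEnd ℂ (w x) with hc
  have hre : ∀ {g : ℝ → ℂ} {g' : ℂ} {y : ℝ}, HasDerivAt g g' y →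
      HasDerivAt (fun s => (c * g s).re) (c * g').re y := by
    intro g g' y hg
    exact (Complex.reCLM.hasFDerivAt.comp_hasDerivAt y (hg.const_mul c))
  have hφ1 : ∀ᶠ y in nhds x, HasDerivAt (fun s => (c * w s).re) (c * w' y).re y :=
    h1.mono fun y hy => hre hy
  have hφ2 := hre h2
  have hlmax : IsLocalMax (fun s => (c * w s).re) x := by
    filter_upwards [hmax] with y hy
    calc (c * w y).re ≤ ‖c * w y‖ := Complex.re_le_norm _
      _ ≤ ‖w x‖ * ‖w x‖ := by
        rw [norm_mul, hc, RCLike.norm_conj]; gcongr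
      _ = (c * w x).re := by
        rw [hc, ← Complex.normSq_eq_conj_mul_self, Complex.ofReal_re, Complex.normSq_eq_norm_sq, sq]
  have hd : deriv (fun s => (c * w s).re) =ᶠ[nhds x] fun y => (c * w' y).re :=
    hφ1.mono fun y hy => hy.deriv
  have hdd : deriv (deriv (fun s => (c * w s).re)) x = (c * d).re := by
    rw [hd.deriv_eq]; exact hφ2.deriv
  by_contra! hpos
  have hlmin : IsLocalMin (fun s => (c * w s).re) x :=
    isLocalMin_of_deriv_deriv_pos (by rw [hdd]; exact hpos) hlmax.deriv_eq_zero
      hφ1.self_of_nhds.continuousAt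
  have hconst : (fun s => (c * w s).re) =ᶠ[nhds x] fun _ => (c * w x).re := by
    filter_upwards [hlmax, hlmin] with y h3 h4 using le_antisymm h3 h4
  have h0 : deriv (deriv (fun s => (c * w s).re)) x = 0 := by
    rw [hconst.deriv.deriv_eq]
    simp
  linarith [hdd ▸ h0]

end HasSecondDerivAt

/-- A lower bound for `Re (conj w * ((Q + l) w + g))` when `Q` is bounded by `M`. -/
theorem re_conj_mul_ge {M : ℝ} {w Q l g : ℂ} (hQ : ‖Q‖ ≤ M) :
    (l.re - M) * ‖w‖ ^ 2 - ‖g‖ * ‖w‖ ≤ (starRingEnd ℂ w * ((Q + l) * w + g)).re := by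
  have h1 : starRingEnd ℂ w * ((Q + l) * w + g)
      = ((‖w‖ ^ 2 : ℝ) : ℂ) * (Q + l) + starRingEnd ℂ w * g := by
    rw [← Complex.normSq_eq_norm_sq, ← Complex.mul_conj]; ring
  rw [h1, Complex.add_re, Complex.re_ofReal_mul, Complex.add_re]
  have h2 : -M ≤ Q.re := by
    have := (abs_le.mp ((Complex.abs_re_le_norm Q).trans hQ)).1
    linarith
  have h3 : -(‖g‖ * ‖w‖) ≤ (starRingEnd ℂ w * g).re := by
    have := (abs_le.mp (Complex.abs_re_le_norm (starRingEnd ℂ w * g))).1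
    rw [norm_mul, RCLike.norm_conj] at this
    linarith [mul_comm ‖g‖ ‖w‖]
  nlinarith [sq_nonneg ‖w‖]

/-- The maximum principle for `w'' = (q + l) w + g` with complex `q` and `l`: it holds once `Re l`
exceeds a bound of `|q|`. -/
theorem norm_le_of_elliptic {b M m : ℝ} {q w g : ℝ → ℂ} {l : ℂ} (hb : 0 ≤ b)
    (hq : ∀ x ∈ Set.Icc (-b) b, ‖q x‖ ≤ M) (hl : M < l.re)
    (hw : ContinuousOn w (Set.Icc (-b) b))
    (hode : ∀ x ∈ Set.Ioo (-b) b, HasSecondDerivAt w ((q x + l) * w x + g x) x)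
    (hg : ∀ x ∈ Set.Icc (-b) b, ‖g x‖ ≤ m * (l.re - M))
    (hright : ‖w b‖ ≤ m) (hleft : ‖w (-b)‖ ≤ m) : ∀ x ∈ Set.Icc (-b) b, ‖w x‖ ≤ m := by
  obtain ⟨x₀, hx₀, hmax⟩ := isCompact_Icc.exists_isMaxOn
    (Set.nonempty_Icc.2 (by linarith : -b ≤ b)) hw.norm
  suffices h : ‖w x₀‖ ≤ m from fun x hx => (hmax hx).trans h
  rcases eq_or_ne x₀ b with rfl | h1
  · exact hright
  rcases eq_or_ne x₀ (-b) with rfl | h2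
  · exact hleft
  have hx : x₀ ∈ Set.Ioo (-b) b := ⟨lt_of_le_of_ne hx₀.1 h2.symm, lt_of_le_of_ne hx₀.2 h1⟩
  have h3 := (hode x₀ hx).re_conj_mul_nonpos (by
    filter_upwards [Icc_mem_nhds hx.1 hx.2] with y hy using hmax hy)
  have h4 := re_conj_mul_ge (w := w x₀) (l := l) (g := g x₀) (hq x₀ hx₀)
  by_contra! hlt
  have hw0 : 0 < ‖w x₀‖ := lt_of_le_of_lt ((norm_nonneg _).trans hright) hlt
  have h5 : ‖g x₀‖ * ‖w x₀‖ ≤ m * (l.re - M) * ‖w x₀‖ := by gcongr; exact hg x₀ hx₀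
  have h6 : 0 < (l.re - M) * ‖w x₀‖ * (‖w x₀‖ - m) :=
    mul_pos (mul_pos (by linarith) hw0) (by linarith)
  nlinarith

/-- A solution of `v_xx - q v = v_t` is bounded through its values on the parabolic boundary. The
factor `exp (-(M + 1) t)` turns a positive maximum of the modulus inside into a contradiction;
maxima are taken over `0 ≤ t ≤ t₁` with `t₁ < τ`, because the equation is not assumed at `t = τ`. -/
theorem norm_le_of_parabolic {b τ M η : ℝ} {q : ℝ → ℂ} {v : ℝ → ℝ → ℂ} (hτ : 0 < τ)
    (hq : ∀ x ∈ Set.Icc (-b) b, ‖q x‖ ≤ M)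
    (hv : ContinuousOn (fun p : ℝ × ℝ => v p.1 p.2) (Set.Icc (-b) b ×ˢ Set.Icc 0 τ))
    (hpde : ∀ x ∈ Set.Ioo (-b) b, ∀ t ∈ Set.Ioo 0 τ, ∃ d,
      HasSecondDerivAt (fun y => v y t) (q x * v x t + d) x ∧ HasDerivAt (v x) d t)
    (hbottom : ∀ x ∈ Set.Icc (-b) b, ‖v x 0‖ ≤ η)
    (hright : ∀ t ∈ Set.Icc 0 τ, ‖v b t‖ ≤ η) (hleft : ∀ t ∈ Set.Icc 0 τ, ‖v (-b) t‖ ≤ η) :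
    ∀ x ∈ Set.Icc (-b) b, ∀ t ∈ Set.Icc 0 τ, ‖v x t‖ ≤ η * Real.exp ((M + 1) * t) := by
  intro x hx
  have hM : 0 ≤ M := (norm_nonneg _).trans (hq x hx)
  have hη : 0 ≤ η := (norm_nonneg _).trans (hbottom x hx)
  have hlt : ∀ t₁ ∈ Set.Ico 0 τ, ‖v x t₁‖ ≤ η * Real.exp ((M + 1) * t₁) := by
    intro t₁ ht₁
    set W : ℝ × ℝ → ℝ := fun p => Real.exp (-((M + 1) * p.2)) * ‖v p.1 p.2‖ with hW
    have hsub : Set.Icc (-b) b ×ˢ Set.Icc 0 t₁ ⊆ Set.Icc (-b) b ×ˢ Set.Icc 0 τ :=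
      Set.prod_mono subset_rfl (Set.Icc_subset_Icc_right ht₁.2.le)
    have hWc : ContinuousOn W (Set.Icc (-b) b ×ˢ Set.Icc 0 t₁) :=
      (by fun_prop : Continuous fun p : ℝ × ℝ => Real.exp (-((M + 1) * p.2))).continuousOn.mul
        (hv.mono hsub).norm
    obtain ⟨⟨x₀, t₀⟩, hp, hmax⟩ := (isCompact_Icc.prod isCompact_Icc).exists_isMaxOn
      ⟨(x, t₁), hx, ⟨ht₁.1, le_rfl⟩⟩ hWc
    have hx₀ : x₀ ∈ Set.Icc (-b) b := hp.1
    have ht₀ : t₀ ∈ Set.Icc 0 t₁ := hp.2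
    suffices h : W (x₀, t₀) ≤ η by
      have h1 : W (x, t₁) ≤ η := (hmax (Set.mk_mem_prod hx ⟨ht₁.1, le_rfl⟩)).trans h
      simp only [hW, Real.exp_neg] at h1
      rwa [inv_mul_le_iff₀ (Real.exp_pos _), mul_comm] at h1
    have hle : ‖v x₀ t₀‖ ≤ η → W (x₀, t₀) ≤ η := fun h =>
      (mul_le_of_le_one_left (norm_nonneg _) (Real.exp_le_one_iff.2 (by
        have := ht₀.1; simp only [Left.neg_nonpos_iff]; positivity))).trans h
    have ht₀' : t₀ ∈ Set.Icc 0 τ := ⟨ht₀.1, ht₀.2.trans ht₁.2.le⟩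
    rcases eq_or_ne x₀ b with rfl | h1
    · exact hle (hright t₀ ht₀')
    rcases eq_or_ne x₀ (-b) with rfl | h2
    · exact hle (hleft t₀ ht₀')
    rcases eq_or_ne t₀ 0 with rfl | h3
    · exact hle (hbottom x₀ hx₀)
    have hxI : x₀ ∈ Set.Ioo (-b) b := ⟨lt_of_le_of_ne hx₀.1 h2.symm, lt_of_le_of_ne hx₀.2 h1⟩
    have htpos : 0 < t₀ := lt_of_le_of_ne ht₀.1 (Ne.symm h3)
    obtain ⟨d, hd1, hd2⟩ := hpde x₀ hxI t₀ ⟨htpos, ht₀.2.trans_lt ht₁.2⟩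
    have hspace := hd1.re_conj_mul_nonpos (by
      filter_upwards [Icc_mem_nhds hxI.1 hxI.2] with y hy
      have := hmax (Set.mk_mem_prod hy ht₀)
      exact le_of_mul_le_mul_left this (Real.exp_pos _))
    set c := starRingEnd ℂ (v x₀ t₀) with hc
    have hcv : (c * v x₀ t₀).re = ‖v x₀ t₀‖ ^ 2 := by
      rw [hc, mul_comm, Complex.mul_conj, Complex.ofReal_re, Complex.normSq_eq_norm_sq]
    -- the time derivative of `exp (-(M + 1) t) Re (c v)` at its maximum over `[0, t₀]`
    have hder : HasDerivAt (fun t => Real.exp (-((M + 1) * t)) * (c * v x₀ t).re)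
        (Real.exp (-((M + 1) * t₀)) * -((M + 1) * 1) * (c * v x₀ t₀).re
          + Real.exp (-((M + 1) * t₀)) * (c * d).re) t₀ :=
      (((hasDerivAt_id t₀).const_mul (M + 1)).neg.exp).mul
        (Complex.reCLM.hasFDerivAt.comp_hasDerivAt t₀ (hd2.const_mul c))
    have hnonneg : 0 ≤ Real.exp (-((M + 1) * t₀)) * -((M + 1) * 1) * (c * v x₀ t₀).re
          + Real.exp (-((M + 1) * t₀)) * (c * d).re := by
      refine ge_of_tendsto ((hasDerivWithinAt_iff_tendsto_slope' (by simp)).1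
        (hder.hasDerivWithinAt (s := Set.Iio t₀))) ?_
      filter_upwards [Ioo_mem_nhdsLT htpos] with t ht
      have hWt := hmax (Set.mk_mem_prod hx₀ (⟨ht.1.le, ht.2.le.trans ht₀.2⟩ : t ∈ Set.Icc 0 t₁))
      have hWt' : Real.exp (-((M + 1) * t)) * ‖v x₀ t‖
        ≤ Real.exp (-((M + 1) * t₀)) * ‖v x₀ t₀‖ := hWt
      have h4 : (c * v x₀ t).re ≤ ‖v x₀ t₀‖ * ‖v x₀ t‖ := by
        refine (Complex.re_le_norm _).trans ?_
        rw [norm_mul, hc, RCLike.norm_conj]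
      have h5 : Real.exp (-((M + 1) * t)) * (c * v x₀ t).re
          ≤ Real.exp (-((M + 1) * t₀)) * (c * v x₀ t₀).re := by
        rw [hcv]
        calc _ ≤ Real.exp (-((M + 1) * t)) * (‖v x₀ t₀‖ * ‖v x₀ t‖) := by gcongr
          _ = ‖v x₀ t₀‖ * (Real.exp (-((M + 1) * t)) * ‖v x₀ t‖) := by ring
          _ ≤ ‖v x₀ t₀‖ * (Real.exp (-((M + 1) * t₀)) * ‖v x₀ t₀‖) := by gcongr
          _ = _ := by ring
      rw [slope_def_field]
      exact div_nonneg_of_nonpos (by linarith) (by linarith [ht.2])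
    have hE := Real.exp_pos (-((M + 1) * t₀))
    have htime : (M + 1) * ‖v x₀ t₀‖ ^ 2 ≤ (c * d).re := by
      rw [hcv] at hnonneg
      by_contra! hcon
      nlinarith
    have hsplit : (c * (q x₀ * v x₀ t₀ + d)).re = (c * ((q x₀ + 0) * v x₀ t₀ + 0)).re
        + (c * d).re := by
      rw [← Complex.add_re]; congr 1; ring
    have hge := re_conj_mul_ge (w := v x₀ t₀) (l := 0) (g := 0) (hq x₀ hx₀)
    rw [← hc] at hge
    simp only [Complex.zero_re, norm_zero, zero_mul, sub_zero] at hge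
    have hzero : ‖v x₀ t₀‖ ^ 2 ≤ 0 := by nlinarith
    have hz : ‖v x₀ t₀‖ = 0 := by nlinarith [norm_nonneg (v x₀ t₀)]
    exact hle (hz.le.trans hη)
  intro t ht
  rcases lt_or_eq_of_le ht.2 with h | rfl
  · exact hlt t ⟨ht.1, h⟩
  · have hvx : ContinuousOn (fun s => ‖v x s‖) (Set.Icc 0 t) :=
      (hv.comp (f := fun s : ℝ => (x, s)) (by fun_prop) fun s hs => Set.mk_mem_prod hx hs).norm
    have hcl : closure (Set.Ico 0 t) = Set.Icc 0 t := closure_Ico hτ.ne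
    have hmem : t ∈ closure (Set.Ico 0 t) := by rw [hcl]; exact ht
    exact ContinuousWithinAt.closure_le hmem
      ((hvx t ht).mono Set.Ico_subset_Icc_self)
      (by fun_prop : Continuous fun s => η * Real.exp ((M + 1) * s)).continuousWithinAt hlt

/-! ### The Cauchy problem and the formal powers -/

/-- The solution of `y'' - q y = g` with `y 0 = α` and `y' 0 = α f' 0 + β`, by the Pólya
factorization `f (y'' - q y) = (f² (y / f)')'`. -/
noncomputable def cauchySol (f : ℝ → ℂ) (α β : ℂ) (g : ℝ → ℂ) (x : ℝ) : ℂ :=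
  f x * (α + ∫ s in (0 : ℝ)..x, (β + ∫ r in (0 : ℝ)..s, f r * g r) * (f s ^ 2)⁻¹)

section

variable {b : ℝ} {q f g : ℝ → ℂ} {α β : ℂ}

theorem continuous_cauchySol (hc : Continuous f) (h0 : ∀ x, f x ≠ 0) (hg : Continuous g) :
    Continuous (cauchySol f α β g) := by
  have h1 : Continuous fun s => ∫ r in (0 : ℝ)..s, f r * g r :=
    intervalIntegral.continuous_primitive (fun _ _ => (hc.mul hg).intervalIntegrable _ _) 0
  have h2 : Continuous fun s => (β + ∫ r in (0 : ℝ)..s, f r * g r) * (f s ^ 2)⁻¹ :=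
    (continuous_const.add h1).mul ((hc.pow 2).inv₀ fun x => pow_ne_zero 2 (h0 x))
  exact hc.mul (continuous_const.add
    (intervalIntegral.continuous_primitive (fun _ _ => h2.intervalIntegrable _ _) 0))

theorem hasDerivAt_primitive_cauchySol (hc : Continuous f) (h0 : ∀ x, f x ≠ 0)
    (hg : Continuous g) (x : ℝ) :
    HasDerivAt (fun x => α + ∫ s in (0 : ℝ)..x, (β + ∫ r in (0 : ℝ)..s, f r * g r) * (f s ^ 2)⁻¹)
      ((β + ∫ r in (0 : ℝ)..x, f r * g r) * (f x ^ 2)⁻¹) x := by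
  have h1 : Continuous fun s => ∫ r in (0 : ℝ)..s, f r * g r :=
    intervalIntegral.continuous_primitive (fun _ _ => (hc.mul hg).intervalIntegrable _ _) 0
  have h2 : Continuous fun s => (β + ∫ r in (0 : ℝ)..s, f r * g r) * (f s ^ 2)⁻¹ :=
    (continuous_const.add h1).mul ((hc.pow 2).inv₀ fun x => pow_ne_zero 2 (h0 x))
  exact (h2.integral_hasStrictDerivAt 0 x).hasDerivAt.const_add α

theorem IsNonvanishingSolution.hasSecondDerivAt_cauchySol (hf : IsNonvanishingSolution b q f)
    (hc : Continuous f) (h0 : ∀ x, f x ≠ 0) (hg : Continuous g) {x : ℝ}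
    (hx : x ∈ Set.Ioo (-b) b) :
    HasSecondDerivAt (cauchySol f α β g) (q x * cauchySol f α β g x + g x) x := by
  set I : ℝ → ℂ := fun s => β + ∫ r in (0 : ℝ)..s, f r * g r with hI
  set J : ℝ → ℂ := fun x => α + ∫ s in (0 : ℝ)..x, I s * (f s ^ 2)⁻¹ with hJ
  have hI' : ∀ s, HasDerivAt I (f s * g s) s := fun s =>
    (((hc.mul hg).integral_hasStrictDerivAt 0 s).hasDerivAt).const_add β
  have hJ' : ∀ s, HasDerivAt J (I s * (f s ^ 2)⁻¹) s := fun s =>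
    hasDerivAt_primitive_cauchySol hc h0 hg s
  have hfd : ∀ s ∈ Set.Ioo (-b) b, HasDerivAt f (deriv f s) s := fun s hs =>
    (hf.differentiableAt s hs).hasDerivAt
  refine ⟨fun s => deriv f s * J s + I s * (f s)⁻¹, ?_, ?_⟩
  · filter_upwards [Ioo_mem_nhds hx.1 hx.2] with s hs
    refine ((hfd s hs).mul (hJ' s)).congr_deriv ?_
    have := h0 s
    field_simp
  · refine (((hf.differentiableAt_deriv x hx).hasDerivAt.mul (hJ' x)).add
      ((hI' x).mul ((hfd x hx).inv (h0 x)))).congr_deriv ?_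
    have := hf.equation x hx
    rw [sub_eq_zero] at this
    rw [this]
    change _ = q x * (f x * J x) + g x
    have := h0 x
    simp only [Pi.inv_apply]
    field_simp
    ring

/-- A solution of `h'' - q h = g` is determined by its Cauchy data at `0`: `(f h' - h f')' = f g`
and `f h' - h f' = f² (h / f)'`. -/
theorem IsNonvanishingSolution.eq_cauchySol (hb : 0 < b) (hf : IsNonvanishingSolution b q f)
    (hc : Continuous f) (h0 : ∀ x, f x ≠ 0) (hg : Continuous g) {h h' : ℝ → ℂ}
    (hh : ContinuousOn h (Set.Icc (-b) b))
    (hd : ∀ x ∈ Set.Ioo (-b) b, HasDerivAt h (h' x) x)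
    (hdd : ∀ x ∈ Set.Ioo (-b) b, HasDerivAt h' (q x * h x + g x) x) :
    Set.EqOn h (cauchySol f (h 0) (h' 0 - h 0 * deriv f 0) g) (Set.Icc (-b) b) := by
  have hzero : (0 : ℝ) ∈ Set.Ioo (-b) b := ⟨by linarith, hb⟩
  have hfd : ∀ s ∈ Set.Ioo (-b) b, HasDerivAt f (deriv f s) s := fun s hs =>
    (hf.differentiableAt s hs).hasDerivAt
  have huIcc : ∀ x ∈ Set.Ioo (-b) b, Set.uIcc 0 x ⊆ Set.Ioo (-b) b := fun x hx =>
    Set.ordConnected_Ioo.uIcc_subset hzero hx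
  have hW : ∀ x ∈ Set.Ioo (-b) b, h' x * f x - h x * deriv f x
      = (h' 0 - h 0 * deriv f 0) + ∫ r in (0 : ℝ)..x, f r * g r := by
    intro x hx
    have hd1 : ∀ s ∈ Set.Ioo (-b) b,
        HasDerivAt (fun s => h' s * f s - h s * deriv f s) (f s * g s) s := by
      intro s hs
      refine (((hdd s hs).mul (hfd s hs)).sub
        ((hd s hs).mul (hf.differentiableAt_deriv s hs).hasDerivAt)).congr_deriv ?_
      have := hf.equation s hs
      rw [sub_eq_zero] at this
      rw [this]; ring
    rw [intervalIntegral.integral_eq_sub_of_hasDerivAt (fun s hs => hd1 s (huIcc x hx hs))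
      ((hc.mul hg).intervalIntegrable _ _), hf.map_zero]
    ring
  have hIoo : Set.EqOn h (cauchySol f (h 0) (h' 0 - h 0 * deriv f 0) g) (Set.Ioo (-b) b) := by
    intro x hx
    set I : ℝ → ℂ := fun s => (h' 0 - h 0 * deriv f 0) + ∫ r in (0 : ℝ)..s, f r * g r with hI
    have hIc : Continuous I := continuous_const.add
      (intervalIntegral.continuous_primitive (fun _ _ => (hc.mul hg).intervalIntegrable _ _) 0)
    have hd1 : ∀ s ∈ Set.Ioo (-b) b,
        HasDerivAt (fun s => h s / f s) (I s * (f s ^ 2)⁻¹) s := by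
      intro s hs
      refine ((hd s hs).div (hfd s hs) (h0 s)).congr_deriv ?_
      simp only [hI]
      rw [ ← hW s hs, div_eq_mul_inv]
    have := intervalIntegral.integral_eq_sub_of_hasDerivAt (fun s hs => hd1 s (huIcc x hx hs))
      ((hIc.mul ((hc.pow 2).inv₀ fun x => pow_ne_zero 2 (h0 x))).intervalIntegrable _ _)
    change h x = f x * (h 0 + ∫ s in (0 : ℝ)..x, I s * (f s ^ 2)⁻¹)
    rw [this, hf.map_zero]
    field_simp [h0 x]
    ring
  exact hIoo.of_subset_closure hh (continuous_cauchySol hc h0 hg).continuousOn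
    Set.Ioo_subset_Icc_self (by rw [closure_Ioo (by linarith)])

end

theorem cauchySol_congr {b : ℝ} {f f' g g' : ℝ → ℂ} (hf : Set.EqOn f f' (Set.Icc (-b) b))
    (hg : Set.EqOn g g' (Set.Icc (-b) b)) (α β : ℂ) :
    Set.EqOn (cauchySol f α β g) (cauchySol f' α β g') (Set.Icc (-b) b) := by
  intro x hx
  have hsub : ∀ y ∈ Set.Icc (-b) b, Set.uIcc 0 y ⊆ Set.Icc (-b) b := by
    intro y hy
    exact Set.ordConnected_Icc.uIcc_subset
      ⟨by linarith [hy.1.trans hy.2], by linarith [hy.1.trans hy.2]⟩ hy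
  simp only [cauchySol, hf hx]
  congr 2
  refine intervalIntegral.integral_congr fun s hs => ?_
  have hs' := hsub x hx hs
  simp only [hf hs']
  congr 2
  refine intervalIntegral.integral_congr fun r hr => ?_
  simp only [hf (hsub s hs' hr), hg (hsub s hs' hr)]

theorem cauchySol_add {f : ℝ → ℂ} (hc : Continuous f) (h0 : ∀ x, f x ≠ 0) {g g' : ℝ → ℂ}
    (hg : Continuous g) (hg' : Continuous g') (α β α' β' : ℂ) (x : ℝ) :
    cauchySol f (α + α') (β + β') (fun y => g y + g' y) x
      = cauchySol f α β g x + cauchySol f α' β' g' x := by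
  have hI : ∀ {g : ℝ → ℂ}, Continuous g → ∀ β : ℂ,
      Continuous fun s => (β + ∫ r in (0 : ℝ)..s, f r * g r) * (f s ^ 2)⁻¹ := fun hg β =>
    (continuous_const.add (intervalIntegral.continuous_primitive
      (fun _ _ => (hc.mul hg).intervalIntegrable _ _) 0)).mul
      ((hc.pow 2).inv₀ fun x => pow_ne_zero 2 (h0 x))
  simp only [cauchySol]
  have h1 : ∀ s : ℝ, ∫ r in (0 : ℝ)..s, f r * (g r + g' r)
      = (∫ r in (0 : ℝ)..s, f r * g r) + ∫ r in (0 : ℝ)..s, f r * g' r := fun s => by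
    simp only [mul_add]
    exact intervalIntegral.integral_add ((hc.mul hg).intervalIntegrable _ _)
      ((hc.mul hg').intervalIntegrable _ _)
  have h2 := intervalIntegral.integral_add ((hI hg β).intervalIntegrable (μ := MeasureTheory.volume) 0 x)
    ((hI hg' β').intervalIntegrable 0 x)
  simp only [h1]
  rw [show (fun s => (β + β' + ((∫ r in (0 : ℝ)..s, f r * g r) + ∫ r in (0 : ℝ)..s, f r * g' r))
      * (f s ^ 2)⁻¹) = fun s => (β + ∫ r in (0 : ℝ)..s, f r * g r) * (f s ^ 2)⁻¹
      + (β' + ∫ r in (0 : ℝ)..s, f r * g' r) * (f s ^ 2)⁻¹ from by ext s; ring, h2]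
  ring

theorem cauchySol_const_mul (f g : ℝ → ℂ) (c α β : ℂ) (x : ℝ) :
    cauchySol f (c * α) (c * β) (fun y => c * g y) x = c * cauchySol f α β g x := by
  simp only [cauchySol]
  have h1 : ∀ s : ℝ, ∫ r in (0 : ℝ)..s, f r * (c * g r) = c * ∫ r in (0 : ℝ)..s, f r * g r :=
    fun s => by
      rw [← intervalIntegral.integral_const_mul]; congr 1; ext r; ring
  have h2 : ∫ s in (0 : ℝ)..x, (c * β + ∫ r in (0 : ℝ)..s, f r * (c * g r)) * (f s ^ 2)⁻¹
      = c * ∫ s in (0 : ℝ)..x, (β + ∫ r in (0 : ℝ)..s, f r * g r) * (f s ^ 2)⁻¹ := by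
    rw [← intervalIntegral.integral_const_mul]; congr 1; ext s; rw [h1]; ring
  rw [h2]; ring

theorem formalPower_zero (f : ℝ → ℂ) : formalPower f 0 = cauchySol f 1 0 fun _ => 0 := by
  ext x; simp [formalPower, recXTilde, cauchySol]

theorem formalPower_one (f : ℝ → ℂ) : formalPower f 1 = cauchySol f 0 1 fun _ => 0 := by
  ext x; simp [formalPower, recX, cauchySol]

theorem mul_integral_integral_eq_cauchySol (f Y : ℝ → ℂ) (c₁ c₂ : ℂ) (x : ℝ) :
    f x * (c₂ * ∫ s in (0 : ℝ)..x, (c₁ * ∫ r in (0 : ℝ)..s, Y r * f r ^ 2) * (f s ^ 2)⁻¹)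
      = c₂ * c₁ * cauchySol f 0 0 (fun r => f r * Y r) x := by
  simp only [cauchySol, zero_add]
  have h1 : ∀ s : ℝ, ∫ r in (0 : ℝ)..s, Y r * f r ^ 2 = ∫ r in (0 : ℝ)..s, f r * (f r * Y r) :=
    fun s => by congr 1; ext r; ring
  simp only [h1, mul_assoc, intervalIntegral.integral_const_mul]
  ring

/-- The step from `φ_k` to `φ_{k+2}`, which treats odd and even `k` alike. -/
theorem formalPower_add_two (f : ℝ → ℂ) (k : ℕ) (x : ℝ) :
    formalPower f (k + 2) x
      = ((k + 2 : ℕ) : ℂ) * ((k + 1 : ℕ) : ℂ) * cauchySol f 0 0 (formalPower f k) x := by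
  rcases Nat.even_or_odd k with hk | hk
  · have hk2 : ¬ Odd (k + 2) := Nat.not_odd_iff_even.2 (by simpa [parity_simps] using hk)
    have hk0 : ¬ Odd k := Nat.not_odd_iff_even.2 hk
    have hφ : formalPower f k = fun r => f r * recXTilde f k r := by
      ext r; simp only [formalPower, hk0, if_false]
    rw [hφ, ← mul_integral_integral_eq_cauchySol]
    simp only [formalPower, hk2, if_false, recXTilde, hk.neg_one_pow,
      hk.add_one.neg_one_pow, zpow_one, zpow_neg]
  · have hk2 : Odd (k + 2) := by simpa [parity_simps] using hk
    have hφ : formalPower f k = fun r => f r * recX f k r := by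
      ext r; simp only [formalPower, hk, if_true]
    rw [hφ, ← mul_integral_integral_eq_cauchySol]
    simp only [formalPower, hk2, if_true, recX, hk.add_one.neg_one_pow,
      hk2.neg_one_pow, zpow_one, zpow_neg]

/-! ### Transmutation operators -/

section

variable {b : ℝ} {q f : ℝ → ℂ} {K : ℝ → ℝ → ℂ}

theorem continuous_formalPower (hc : Continuous f) (h0 : ∀ x, f x ≠ 0) (k : ℕ) :
    Continuous (formalPower f k) := by
  induction k using Nat.twoStepInduction with
  | zero => rw [formalPower_zero]; exact continuous_cauchySol hc h0 continuous_const
  | one => rw [formalPower_one]; exact continuous_cauchySol hc h0 continuous_const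
  | more k ih _ =>
    rw [funext (formalPower_add_two f k)]
    exact continuous_const.mul (continuous_cauchySol hc h0 ih)

theorem intervalIntegrable_kernel_mul
    (hK : ContinuousOn (fun p : ℝ × ℝ => K p.1 p.2) {p | |p.2| ≤ |p.1| ∧ |p.1| ≤ b})
    {v : ℝ → ℂ} (hv : Continuous v) {x : ℝ} (hx : x ∈ Set.Icc (-b) b) :
    IntervalIntegrable (fun s => K x s * v s) MeasureTheory.volume (-x) x := by
  refine ContinuousOn.intervalIntegrable (ContinuousOn.mul ?_ hv.continuousOn)
  refine hK.comp (f := fun s : ℝ => (x, s)) (by fun_prop) fun s hs => ⟨?_, abs_le.2 hx⟩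
  rw [Set.mem_uIcc] at hs
  change |s| ≤ |x|
  rcases hs with hs | hs
  · exact (abs_le.2 hs).trans (le_abs_self x)
  · exact (abs_le.2 ⟨by linarith, by linarith⟩ : |s| ≤ -x).trans (neg_le_abs x)

theorem volterra_add
    (hK : ContinuousOn (fun p : ℝ × ℝ => K p.1 p.2) {p | |p.2| ≤ |p.1| ∧ |p.1| ≤ b})
    {v w : ℝ → ℂ} (hv : Continuous v) (hw : Continuous w) {x : ℝ} (hx : x ∈ Set.Icc (-b) b) :
    volterra K (fun y => v y + w y) x = volterra K v x + volterra K w x := by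
  simp only [volterra, mul_add]
  rw [intervalIntegral.integral_add (intervalIntegrable_kernel_mul hK hv hx)
    (intervalIntegrable_kernel_mul hK hw hx)]
  ring

theorem volterra_const_mul (K : ℝ → ℝ → ℂ) (c : ℂ) (v : ℝ → ℂ) (x : ℝ) :
    volterra K (fun y => c * v y) x = c * volterra K v x := by
  simp only [volterra]
  rw [mul_add, ← intervalIntegral.integral_const_mul]
  congr 2; ext s; ring

theorem volterra_sum
    (hK : ContinuousOn (fun p : ℝ × ℝ => K p.1 p.2) {p | |p.2| ≤ |p.1| ∧ |p.1| ≤ b})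
    {ι : Type*} (S : Finset ι) {v : ι → ℝ → ℂ} (hv : ∀ i, Continuous (v i)) {x : ℝ}
    (hx : x ∈ Set.Icc (-b) b) :
    volterra K (fun y => ∑ i ∈ S, v i y) x = ∑ i ∈ S, volterra K (v i) x := by
  classical
  induction S using Finset.induction_on with
  | empty => simp [volterra]
  | insert i s hi ih =>
    simp only [Finset.sum_insert hi]
    rw [volterra_add hK (hv i) (continuous_finsetSum s fun j _ => hv j) hx, ih]

/-- After the substitution `s = x r` the kernel is integrated over a fixed interval. This gives the
continuity of `T v` up to the end points, and its derivative at `0`. -/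
theorem exists_volterra_eq (hb : 0 < b)
    (hK : ContinuousOn (fun p : ℝ × ℝ => K p.1 p.2) {p | |p.2| ≤ |p.1| ∧ |p.1| ≤ b})
    {v : ℝ → ℂ} (hv : Continuous v) :
    ∃ Φ : ℝ → ℂ, Continuous Φ ∧ (v 0 = 0 → Φ 0 = 0) ∧
      ∀ x ∈ Set.Icc (-b) b, volterra K v x = v x + x * Φ x := by
  have hbb : -b ≤ b := by linarith
  set P : ℝ → ℝ := fun x => (Set.projIcc (-b) b hbb x : ℝ) with hP
  set Q : ℝ → ℝ := fun x => (Set.projIcc (-1 : ℝ) 1 (by norm_num) x : ℝ) with hQ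
  have hPc : Continuous P := continuous_subtype_val.comp continuous_projIcc
  have hQc : Continuous Q := continuous_subtype_val.comp continuous_projIcc
  have hPm : ∀ x, |P x| ≤ b := fun x => abs_le.2 (Set.projIcc (-b) b hbb x).2
  have hQm : ∀ x, |Q x| ≤ 1 := fun x => abs_le.2 (Set.projIcc (-1 : ℝ) 1 (by norm_num) x).2
  have hcont : Continuous fun p : ℝ × ℝ => K (P p.1) (P p.1 * Q p.2) * v (p.1 * p.2) := by
    refine Continuous.mul ?_ (by fun_prop)
    refine hK.comp_continuous (f := fun p : ℝ × ℝ => (P p.1, P p.1 * Q p.2)) (by fun_prop) ?_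
    intro p
    refine ⟨?_, hPm _⟩
    change |P p.1 * Q p.2| ≤ |P p.1|
    rw [abs_mul]
    exact mul_le_of_le_one_right (abs_nonneg _) (hQm _)
  refine ⟨fun x => ∫ r in (-1 : ℝ)..1, K (P x) (P x * Q r) * v (x * r),
    intervalIntegral.continuous_parametric_intervalIntegral_of_continuous' hcont _ _, ?_, ?_⟩
  · intro h; simp [h]
  · intro x hx
    have hPx : P x = x := by simp only [hP]; rw [Set.projIcc_of_mem hbb hx]
    have hint : ∫ r in (-1 : ℝ)..1, K (P x) (P x * Q r) * v (x * r)
        = ∫ r in (-1 : ℝ)..1, K x (x * r) * v (x * r) := by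
      refine intervalIntegral.integral_congr fun r hr => ?_
      rw [Set.uIcc_of_le (by norm_num)] at hr
      have hQr : Q r = r := by simp only [hQ]; rw [Set.projIcc_of_mem _ hr]
      simp only [hPx, hQr]
    have hsub := intervalIntegral.smul_integral_comp_mul_left (a := -1) (b := 1)
      (fun s => K x s * v s) x
    simp only [mul_neg, mul_one, Complex.real_smul] at hsub
    simp only [volterra, hint, hsub]

/-- `T` maps the powers to the formal powers: both sides solve `h'' - q h = k (k - 1) φ_{k-2}` with
the same Cauchy data at `0`. -/
theorem IsTransmutationKernel.volterra_pow (hb : 0 < b) (hf : IsNonvanishingSolution b q f)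
    (hc : Continuous f) (h0 : ∀ x, f x ≠ 0) (hK : IsTransmutationKernel b q f K) (k : ℕ) :
    ∀ x ∈ Set.Icc (-b) b, volterra K (fun y => (y : ℂ) ^ k) x = formalPower f k x := by
  have hzero : (0 : ℝ) ∈ Set.Ioo (-b) b := ⟨by linarith, hb⟩
  -- the Cauchy data of `T v` at `0`, for `v` vanishing there
  have key : ∀ v : ℝ → ℂ, ContDiff ℝ 2 v → v 0 = 0 → ∀ g : ℝ → ℂ, Continuous g →
      (∀ x ∈ Set.Ioo (-b) b, volterra K (deriv (deriv v)) x = g x) →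
      Set.EqOn (volterra K v) (cauchySol f 0 (deriv v 0) g) (Set.Icc (-b) b) := by
    intro v hv hv0 g hg hvg
    obtain ⟨Φ, hΦ, hΦ0, heq⟩ := exists_volterra_eq hb hK.continuousOn hv.continuous
    have hcont : ContinuousOn (volterra K v) (Set.Icc (-b) b) :=
      ContinuousOn.congr (f := fun x => v x + x * Φ x) (Continuous.continuousOn
        (hv.continuous.add (Complex.continuous_ofReal.mul hΦ))) heq
    have hval : volterra K v 0 = 0 := by simp [volterra, hv0]
    have hder : deriv (volterra K v) 0 = deriv v 0 := by
      have hΦd : HasDerivAt (fun x : ℝ => (x : ℂ) * Φ x) 0 0 := by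
        rw [hasDerivAt_iff_tendsto_slope]
        have h1 : Filter.Tendsto Φ (nhdsWithin 0 {0}ᶜ) (nhds 0) := by
          have := hΦ.continuousAt (x := 0)
          rw [ContinuousAt, hΦ0 hv0] at this
          exact this.mono_left nhdsWithin_le_nhds
        refine h1.congr' ?_
        filter_upwards [self_mem_nhdsWithin] with x hx
        have hx' : (x : ℂ) ≠ 0 := by exact_mod_cast hx
        simp [slope_def_module, hx']
      have h2 := ((hv.differentiable (by norm_num)) 0).hasDerivAt.add hΦd
      rw [add_zero] at h2
      refine (h2.congr_of_eventuallyEq ?_).deriv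
      filter_upwards [Icc_mem_nhds hzero.1 hzero.2] with x hx using heq x hx
    have := hf.eq_cauchySol hb hc h0 hg (h' := deriv (volterra K v)) hcont
      (fun x hx => (hK.intertwines v hv x hx).1.hasDerivAt) fun x hx => by
        obtain ⟨_, h2, h3⟩ := hK.intertwines v hv x hx
        refine h2.hasDerivAt.congr_deriv ?_
        rw [← hvg x hx, ← h3]; ring
    rwa [hval, hder, zero_mul, sub_zero] at this
  have hpow : ∀ n : ℕ, ContDiff ℝ 2 fun y : ℝ => (y : ℂ) ^ n := fun n =>
    Complex.ofRealCLM.contDiff.pow n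
  have hd : ∀ n : ℕ, deriv (fun y : ℝ => (y : ℂ) ^ n) = fun y : ℝ => (n : ℂ) * (y : ℂ) ^ (n - 1) := by
    intro n; ext y
    have h1 := ((hasDerivAt_id y).ofReal_comp).pow n
    have h2 : HasDerivAt (fun y : ℝ => (y : ℂ) ^ n) ((n : ℂ) * (y : ℂ) ^ (n - 1)) y :=
      h1.congr_deriv (by simp)
    exact h2.deriv
  induction k using Nat.twoStepInduction with
  | zero =>
    intro x hx
    simp only [pow_zero]
    rw [hK.map_one x hx]; simp [formalPower, recXTilde]
  | one =>
    rw [formalPower_one]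
    have := key (fun y => (y : ℂ) ^ 1) (hpow 1) (by simp) (fun _ => 0) continuous_const (by
      intro x _; rw [hd]; simp [volterra])
    rw [hd] at this
    intro x hx
    simpa using this hx
  | more k ih _ =>
    intro x hx
    set c : ℂ := ((k + 2 : ℕ) : ℂ) * ((k + 1 : ℕ) : ℂ) with hcdef
    have := key (fun y => (y : ℂ) ^ (k + 2)) (hpow _) (by simp) (fun x => c * formalPower f k x)
      (continuous_const.mul (continuous_formalPower hc h0 k)) (by
        intro x hx
        have h2 : deriv (deriv fun y : ℝ => (y : ℂ) ^ (k + 2)) = fun y : ℝ => c * (y : ℂ) ^ k := by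
          rw [hd]
          ext y
          have h3 := hd (k + 1)
          rw [show k + 2 - 1 = k + 1 from rfl, deriv_const_mul_field, h3]
          simp [hcdef, mul_assoc]
        rw [h2, volterra_const_mul, ih x (Set.Ioo_subset_Icc_self hx)]) hx
    rw [this, hd, formalPower_add_two, ← hcdef, ← cauchySol_const_mul]
    simp

theorem IsTransmutationKernel.volterra_heatPoly (hb : 0 < b) (hf : IsNonvanishingSolution b q f)
    (hc : Continuous f) (h0 : ∀ x, f x ≠ 0) (hK : IsTransmutationKernel b q f K) (n : ℕ) {x : ℝ}
    (hx : x ∈ Set.Icc (-b) b) (t : ℝ) :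
    volterra K (fun y => heatPoly n y t) x = transmutedHeatPoly f n x t := by
  set v : ℕ → ℝ → ℂ := fun k y => ((n.factorial : ℂ) * ((t : ℂ) ^ k
    / ((k.factorial : ℂ) * ((n - 2 * k).factorial : ℂ)))) * (y : ℂ) ^ (n - 2 * k) with hv
  have hvc : ∀ k, Continuous (v k) := fun k => continuous_const.mul (Complex.continuous_ofReal.pow _)
  have h1 : (fun y : ℝ => heatPoly n y t) = fun y : ℝ => ∑ k ∈ Finset.range (n / 2 + 1), v k y := by
    ext y
    rw [heatPoly, Finset.mul_sum]
    refine Finset.sum_congr rfl fun k _ => ?_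
    simp only [hv]; ring
  rw [h1, volterra_sum hK.continuousOn _ hvc hx, transmutedHeatPoly, Finset.mul_sum]
  refine Finset.sum_congr rfl fun k _ => ?_
  rw [hv, volterra_const_mul, hK.volterra_pow hb hf hc h0 _ x hx]
  ring

end

/-! ### Entire functions given by rapidly decreasing coefficients -/

section

variable {a : ℕ → ℂ} {K C : ℝ}

theorem summable_norm_mul_pow (h : ∀ n, ‖a n‖ ≤ K * C ^ n / n.factorial) (z : ℂ) :
    Summable fun n => ‖a n * z ^ n‖ := by
  refine Summable.of_nonneg_of_le (fun _ => norm_nonneg _) (fun n => ?_)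
    ((Real.summable_pow_div_factorial (C * ‖z‖)).mul_left K)
  rw [norm_mul, norm_pow, mul_pow]
  calc ‖a n‖ * ‖z‖ ^ n ≤ K * C ^ n / n.factorial * ‖z‖ ^ n := by gcongr; exact h n
    _ = _ := by ring

theorem hasFPowerSeriesOnBall_tsum_mul_pow (h : ∀ n, ‖a n‖ ≤ K * C ^ n / n.factorial) :
    HasFPowerSeriesOnBall (fun z : ℂ => ∑' n, a n * z ^ n)
      (FormalMultilinearSeries.ofScalars ℂ a) 0 ⊤ := by
  have hr : (FormalMultilinearSeries.ofScalars ℂ a).radius = ⊤ := by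
    refine FormalMultilinearSeries.radius_eq_top_of_summable_norm _ fun r => ?_
    refine (summable_norm_mul_pow h (r : ℂ)).congr fun n => ?_
    rw [FormalMultilinearSeries.ofScalars_norm, norm_mul, norm_pow]
    simp
  have := (FormalMultilinearSeries.ofScalars ℂ a).hasFPowerSeriesOnBall (by rw [hr]; simp)
  rw [hr] at this
  convert! this using 1
  ext z
  exact (FormalMultilinearSeries.ofScalars_sum_eq a z).symm

theorem differentiable_tsum_mul_pow (h : ∀ n, ‖a n‖ ≤ K * C ^ n / n.factorial) :
    Differentiable ℂ fun z : ℂ => ∑' n, a n * z ^ n := fun z =>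
  ((hasFPowerSeriesOnBall_tsum_mul_pow h).analyticAt_of_mem (by simp)).differentiableAt

/-- Liouville's theorem, read on the coefficients. -/
theorem coeff_eq_zero_of_bounded (h : ∀ n, ‖a n‖ ≤ K * C ^ n / n.factorial) {B : ℝ}
    (hB : ∀ z : ℂ, ‖∑' n, a n * z ^ n‖ ≤ B) {n : ℕ} (hn : n ≠ 0) : a n = 0 := by
  have hconst : (fun z : ℂ => ∑' n, a n * z ^ n) = fun _ => ∑' n, a n * (0 : ℂ) ^ n := by
    ext z
    refine (differentiable_tsum_mul_pow h).apply_eq_apply_of_bounded ?_ z 0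
    exact isBounded_iff_forall_norm_le.2 ⟨B, by rintro _ ⟨z, rfl⟩; exact hB z⟩
  have h1 := (hasFPowerSeriesOnBall_tsum_mul_pow h).hasFPowerSeriesAt
  rw [hconst] at h1
  have h2 := h1.eq_formalMultilinearSeries (hasFPowerSeriesAt_const (𝕜 := ℂ) (e := (0 : ℂ)))
  have h3 := congrFun h2 n
  rw [constFormalMultilinearSeries_apply_of_nonzero hn] at h3
  exact (FormalMultilinearSeries.ofScalars_eq_zero ℂ n).1 h3

theorem norm_tsum_le_exp_sqrt (hK : 0 ≤ K) (hC : 0 ≤ C)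
    (h : ∀ n, ‖a n‖ ≤ K * C ^ n / (2 * n).factorial) (z : ℂ) :
    ‖∑' n, a n * z ^ n‖ ≤ K * Real.exp (√C * √‖z‖) := by
  have h1 := (Real.hasSum_cosh (√(C * ‖z‖))).mul_left K
  have h2 : ‖∑' n, a n * z ^ n‖ ≤ K * Real.cosh (√(C * ‖z‖)) := by
    refine tsum_of_norm_bounded h1 fun n => ?_
    rw [norm_mul, norm_pow, pow_mul, Real.sq_sqrt (by positivity), mul_pow]
    calc ‖a n‖ * ‖z‖ ^ n ≤ K * C ^ n / (2 * n).factorial * ‖z‖ ^ n := by gcongr; exact h n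
      _ = _ := by ring
  refine h2.trans ?_
  rw [← Real.sqrt_mul hC]
  gcongr
  rw [Real.cosh_eq]
  have : Real.exp (-√(C * ‖z‖)) ≤ Real.exp √(C * ‖z‖) :=
    Real.exp_le_exp.2 (by linarith [Real.sqrt_nonneg (C * ‖z‖)])
  linarith

/-- A Phragmén–Lindelöf principle: an entire function of order `1/2` that is bounded on a right
half-plane is bounded. The map `w ↦ m + i w²` takes the first quadrant to the complementary
half-plane, and turns order `1/2` into order `1 < 2`. -/
theorem norm_le_of_bounded_halfPlane {F : ℂ → ℂ} {m A B : ℝ} (hF : Differentiable ℂ F)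
    (hB : 0 ≤ B) (hK : 0 ≤ K) (hgrowth : ∀ z, ‖F z‖ ≤ K * Real.exp (B * √‖z‖))
    (hright : ∀ z : ℂ, m ≤ z.re → ‖F z‖ ≤ A) (z : ℂ) : ‖F z‖ ≤ A := by
  rcases le_or_gt m z.re with hz | hz
  · exact hright z hz
  obtain ⟨w₀, hw₀⟩ := IsAlgClosed.exists_pow_nat_eq (-Complex.I * (z - m)) (n := 2) (by norm_num)
  have him : 0 < w₀.re * w₀.im := by
    have := congrArg Complex.im hw₀
    simp [sq] at this
    linarith
  obtain ⟨w, hw, hre, hwim⟩ : ∃ w : ℂ, w ^ 2 = -Complex.I * (z - m) ∧ 0 ≤ w.re ∧ 0 ≤ w.im := by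
    rcases pos_and_pos_or_neg_and_neg_of_mul_pos him with h | h
    · exact ⟨w₀, hw₀, h.1.le, h.2.le⟩
    · exact ⟨-w₀, by rw [neg_sq, hw₀], by simpa using h.1.le, by simpa using h.2.le⟩
  have hzw : z = m + Complex.I * w ^ 2 := by
    rw [hw, ← mul_assoc]; simp
  rw [hzw]
  refine PhragmenLindelof.quadrant_I (f := fun w => F (m + Complex.I * w ^ 2)) (C := A)
    (Differentiable.diffContOnCl (hF.comp (by fun_prop))) ⟨1, by norm_num, B, ?_⟩ ?_ ?_ hre hwim
  · refine Asymptotics.IsBigO.of_bound (K * Real.exp (B * √|m|)) (.of_forall fun w => ?_)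
    refine (hgrowth _).trans ?_
    rw [Real.norm_of_nonneg (Real.exp_pos _).le, Real.rpow_one, mul_assoc, ← Real.exp_add, ← mul_add]
    gcongr
    refine Real.sqrt_le_iff.2 ⟨by positivity, ?_⟩
    have h1 : ‖(m : ℂ) + Complex.I * w ^ 2‖ ≤ |m| + ‖w‖ ^ 2 := by
      refine (norm_add_le _ _).trans ?_
      simp
    have h2 := Real.sq_sqrt (abs_nonneg m)
    nlinarith [mul_nonneg (Real.sqrt_nonneg |m|) (norm_nonneg w)]
  · intro x _
    exact hright _ (by simp [← Complex.ofReal_pow])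
  · intro x _
    refine hright _ ?_
    rw [mul_pow, Complex.I_sq]
    simp [← Complex.ofReal_pow]

end

/-! ### Duality -/

/-- A point annihilated by every functional that vanishes on a subspace lies in its closure. -/
theorem Submodule.mem_topologicalClosure_of_forall_dual {E : Type*} [NormedAddCommGroup E]
    [NormedSpace ℂ E] (S : Submodule ℂ E) {x : E}
    (h : ∀ L : E →L[ℂ] ℂ, (∀ s ∈ S, L s = 0) → L x = 0) : x ∈ S.topologicalClosure := by
  by_contra hx
  have hconv : Convex ℝ (S.topologicalClosure : Set E) :=
    (S.topologicalClosure.restrictScalars ℝ).convex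
  obtain ⟨L, u, hLu, hux⟩ := RCLike.geometric_hahn_banach_closed_point (𝕜 := ℂ) hconv
    S.isClosed_topologicalClosure hx
  have hzero : ∀ s ∈ S, L s = 0 := by
    intro s hs
    by_contra hne
    have hmem : (((u + 1 : ℝ) : ℂ) / L s) • s ∈ S.topologicalClosure :=
      S.le_topologicalClosure (S.smul_mem _ hs)
    have h1 := hLu _ hmem
    rw [map_smul, smul_eq_mul, div_mul_cancel₀ _ hne] at h1
    simp at h1
    linarith
  have h0 : (0 : ℝ) < u := by simpa using hLu 0 (zero_mem _)
  rw [h L hzero] at hux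
  simp at hux
  linarith

/-- Complex form of the Weierstrass theorem on an interval: a functional is determined by its values
at the real powers. -/
theorem ContinuousMap.dual_eq_zero_of_forall_pow {a b : ℝ} (L : C(Set.Icc a b, ℂ) →L[ℂ] ℂ)
    (p : ℕ → C(Set.Icc a b, ℂ)) (hp : ∀ n x, p n x = ((x : ℝ) : ℂ) ^ n)
    (h : ∀ n, L (p n) = 0) : L = 0 := by
  set ι : C(Set.Icc a b, ℝ) →L[ℝ] C(Set.Icc a b, ℂ) :=
    Complex.ofRealCLM.compLeftContinuous ℝ (Set.Icc a b) with hι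
  set L' : C(Set.Icc a b, ℝ) →L[ℝ] ℂ := (L.restrictScalars ℝ).comp ι with hL'
  have hpoly : ∀ P : Polynomial ℝ, L' (P.toContinuousMapOn (Set.Icc a b)) = 0 := by
    intro P
    have h1 : ι (P.toContinuousMapOn (Set.Icc a b))
        = ∑ i ∈ Finset.range (P.natDegree + 1), ((P.coeff i : ℝ) : ℂ) • p i := by
      ext x
      simp [hι, hp, Polynomial.eval_eq_sum_range]
    rw [hL', ContinuousLinearMap.comp_apply, h1]
    simp [h]
  have hreal : L' = 0 := by
    have hcl : IsClosed {g : C(Set.Icc a b, ℝ) | L' g = 0} :=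
      isClosed_eq L'.continuous continuous_const
    ext1 g
    have hg : g ∈ closure (polynomialFunctions (Set.Icc a b) : Set C(Set.Icc a b, ℝ)) := by
      rw [← Subalgebra.topologicalClosure_coe, polynomialFunctions_closure_eq_top]; trivial
    refine closure_minimal ?_ hcl hg
    rintro _ ⟨P, -, rfl⟩
    exact hpoly P
  ext g
  set gr : C(Set.Icc a b, ℝ) := ⟨fun x => (g x).re, by fun_prop⟩
  set gi : C(Set.Icc a b, ℝ) := ⟨fun x => (g x).im, by fun_prop⟩
  have hg : g = ι gr + Complex.I • ι gi := by
    ext x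
    simp [hι, gr, gi, mul_comm Complex.I]
  have h1 : L (ι gr) = 0 := DFunLike.congr_fun hreal gr
  have h2 : L (ι gi) = 0 := DFunLike.congr_fun hreal gi
  rw [hg, map_add, map_smul, h1, h2]
  simp

/-! ### The right inverse of `d²/dx² - q` on `C[-b, b]` -/

/-- A bound with the weights `|x| ^ n`, whose iteration produces factorials. -/
theorem norm_integral_mul_le {b A k : ℝ} {n : ℕ} {m g : ℝ → ℂ}
    (hA : ∀ x ∈ Set.Icc (-b) b, ‖m x‖ ≤ A) (hg : ∀ x ∈ Set.Icc (-b) b, ‖g x‖ ≤ k * |x| ^ n)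
    {x : ℝ} (hx : x ∈ Set.Icc (-b) b) :
    ‖∫ r in (0 : ℝ)..x, m r * g r‖ ≤ A * k / (n + 1) * |x| ^ (n + 1) := by
  have hA0 : 0 ≤ A := (norm_nonneg _).trans (hA x hx)
  have h0 : (0 : ℝ) ∈ Set.Icc (-b) b := by
    constructor <;> linarith [hx.1.trans hx.2]
  have hsub : Set.uIoc 0 x ⊆ Set.Icc (-b) b :=
    Set.uIoc_subset_uIcc.trans (Set.ordConnected_Icc.uIcc_subset h0 hx)
  rw [intervalIntegral.norm_integral_eq_norm_integral_uIoc]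
  refine (MeasureTheory.norm_integral_le_of_norm_le (g := fun r => A * k * |r - 0| ^ n) ?_ ?_).trans ?_
  · exact (by fun_prop : Continuous fun r : ℝ => A * k * |r - 0| ^ n).integrableOn_uIoc
  · refine (MeasureTheory.ae_restrict_iff' measurableSet_uIoc).2 (.of_forall fun r hr => ?_)
    rw [norm_mul, sub_zero, mul_assoc]
    exact mul_le_mul (hA r (hsub hr)) (hg r (hsub hr)) (norm_nonneg _) hA0
  · rw [MeasureTheory.integral_const_mul, integral_pow_abs_sub_uIoc, sub_zero]
    exact le_of_eq (by ring)

theorem exists_norm_le_of_continuous {b : ℝ} {m : ℝ → ℂ} (hm : Continuous m) :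
    ∃ A : ℝ, 0 ≤ A ∧ ∀ x ∈ Set.Icc (-b) b, ‖m x‖ ≤ A := by
  obtain ⟨A, hA⟩ := (isCompact_Icc (a := -b) (b := b)).exists_bound_of_continuousOn hm.continuousOn
  exact ⟨max A 0, le_max_right _ _, fun x hx => (hA x hx).trans (le_max_left _ _)⟩

section

variable {b : ℝ} {f : ℝ → ℂ}

theorem exists_norm_cauchySol_le (hc : Continuous f) (h0 : ∀ x, f x ≠ 0) :
    ∃ C : ℝ, 0 ≤ C ∧ ∀ (g : ℝ → ℂ) (k : ℝ) (n : ℕ),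
      (∀ x ∈ Set.Icc (-b) b, ‖g x‖ ≤ k * |x| ^ n) → ∀ x ∈ Set.Icc (-b) b,
        ‖cauchySol f 0 0 g x‖ ≤ C * k / ((n + 1) * (n + 2)) * |x| ^ (n + 2) := by
  obtain ⟨A, hA0, hA⟩ := exists_norm_le_of_continuous (b := b) hc
  obtain ⟨B, hB0, hB⟩ := exists_norm_le_of_continuous (b := b) ((hc.pow 2).inv₀ fun x => pow_ne_zero 2 (h0 x))
  refine ⟨A * B * A, by positivity, fun g k n hg x hx => ?_⟩
  have h1 : ∀ s ∈ Set.Icc (-b) b, ‖∫ r in (0 : ℝ)..s, f r * g r‖ ≤ A * k / (n + 1) * |s| ^ (n + 1) :=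
    fun s hs => norm_integral_mul_le hA hg hs
  have h2 := norm_integral_mul_le hB h1 hx
  simp only [cauchySol, zero_add]
  rw [norm_mul]
  calc _ ≤ A * (B * (A * k / (n + 1)) / ((n + 1 : ℕ) + 1) * |x| ^ (n + 1 + 1)) := by
        gcongr
        · exact hA x hx
        · refine le_of_eq_of_le ?_ h2
          congr 2; ext s; simp [mul_comm]
    _ = _ := by push_cast; field_simp; ring

/-- `cauchySol` as a map on continuous functions on `[-b, b]`. -/
noncomputable def cauchySolMap (hb : -b ≤ b) (hc : Continuous f) (h0 : ∀ x, f x ≠ 0) (α β : ℂ)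
    (g : C(Set.Icc (-b) b, ℂ)) : C(Set.Icc (-b) b, ℂ) where
  toFun x := cauchySol f α β (Set.IccExtend hb g) x
  continuous_toFun := (continuous_cauchySol hc h0 (g.continuous.Icc_extend' (h := hb))).comp
    continuous_subtype_val

theorem norm_le_of_weighted_bound {g : C(Set.Icc (-b) b, ℂ)} {k : ℝ} {n : ℕ} (hb : 0 ≤ b)
    (hk : 0 ≤ k) (h : ∀ x : Set.Icc (-b) b, ‖g x‖ ≤ k * |(x : ℝ)| ^ n) : ‖g‖ ≤ k * b ^ n := by
  refine (ContinuousMap.norm_le _ (by positivity)).2 fun x => (h x).trans ?_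
  gcongr
  exact abs_le.2 x.2

theorem exists_norm_cauchySolMap_le (hb : -b ≤ b) (hc : Continuous f) (h0 : ∀ x, f x ≠ 0) :
    ∃ C : ℝ, 0 ≤ C ∧ ∀ (g : C(Set.Icc (-b) b, ℂ)) (k : ℝ) (n : ℕ),
      (∀ x : Set.Icc (-b) b, ‖g x‖ ≤ k * |(x : ℝ)| ^ n) → ∀ x : Set.Icc (-b) b,
        ‖cauchySolMap hb hc h0 0 0 g x‖ ≤ C * k / ((n + 1) * (n + 2)) * |(x : ℝ)| ^ (n + 2) := by
  obtain ⟨C, hC, h⟩ := exists_norm_cauchySol_le (b := b) hc h0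
  refine ⟨C, hC, fun g k n hg x => h _ k n (fun y hy => ?_) x x.2⟩
  rw [Set.IccExtend_of_mem hb g hy]
  exact hg ⟨y, hy⟩

theorem cauchySolMap_add (hb : -b ≤ b) (hc : Continuous f) (h0 : ∀ x, f x ≠ 0) (α β α' β' : ℂ)
    (g g' : C(Set.Icc (-b) b, ℂ)) :
    cauchySolMap hb hc h0 (α + α') (β + β') (g + g')
      = cauchySolMap hb hc h0 α β g + cauchySolMap hb hc h0 α' β' g' := by
  ext x
  exact cauchySol_add hc h0 (g.continuous.Icc_extend' (h := hb)) (g'.continuous.Icc_extend' (h := hb))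
    α β α' β' x

theorem cauchySolMap_smul (hb : -b ≤ b) (hc : Continuous f) (h0 : ∀ x, f x ≠ 0) (c α β : ℂ)
    (g : C(Set.Icc (-b) b, ℂ)) :
    cauchySolMap hb hc h0 (c * α) (c * β) (c • g) = c • cauchySolMap hb hc h0 α β g := by
  ext x
  exact cauchySol_const_mul f (Set.IccExtend hb g) c α β x

/-- The right inverse `R` of `d²/dx² - q` that produces zero Cauchy data at `0`. -/
noncomputable def cauchyInv (hb : -b ≤ b) (hc : Continuous f) (h0 : ∀ x, f x ≠ 0) :
    C(Set.Icc (-b) b, ℂ) →L[ℂ] C(Set.Icc (-b) b, ℂ) :=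
  LinearMap.mkContinuousOfExistsBound
    { toFun := cauchySolMap hb hc h0 0 0
      map_add' := fun g g' => by
        have := cauchySolMap_add hb hc h0 0 0 0 0 g g'
        rwa [add_zero] at this
      map_smul' := fun c g => by
        have := cauchySolMap_smul hb hc h0 c 0 0 g
        rwa [mul_zero] at this } (by
    obtain ⟨C, hC, h⟩ := exists_norm_cauchySolMap_le hb hc h0
    refine ⟨C / 2 * b ^ 2, fun g => ?_⟩
    have h1 := h g ‖g‖ 0 (fun x => by simpa using g.norm_coe_le_norm x)
    have h2 := norm_le_of_weighted_bound (by linarith) (by positivity) h1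
    refine h2.trans (le_of_eq ?_)
    push_cast; ring)

theorem cauchyInv_apply (hb : -b ≤ b) (hc : Continuous f) (h0 : ∀ x, f x ≠ 0)
    (g : C(Set.Icc (-b) b, ℂ)) : cauchyInv hb hc h0 g = cauchySolMap hb hc h0 0 0 g := rfl

theorem exists_norm_cauchyInv_pow_le (hb : -b ≤ b) (hc : Continuous f) (h0 : ∀ x, f x ≠ 0) :
    ∃ D : ℝ, 0 ≤ D ∧ ∀ n : ℕ, ‖cauchyInv hb hc h0 ^ n‖ ≤ D ^ n / (2 * n).factorial := by
  obtain ⟨C, hC, h⟩ := exists_norm_cauchySolMap_le hb hc h0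
  have hb0 : 0 ≤ b := by linarith
  refine ⟨C * b ^ 2, by positivity, fun n => ContinuousLinearMap.opNorm_le_bound _ (by positivity)
    fun g => ?_⟩
  have hpt : ∀ n : ℕ, ∀ x : Set.Icc (-b) b, ‖(cauchyInv hb hc h0 ^ n) g x‖
      ≤ (C ^ n / (2 * n).factorial * ‖g‖) * |(x : ℝ)| ^ (2 * n) := by
    intro n
    induction n with
    | zero => intro x; simpa using g.norm_coe_le_norm x
    | succ n ih =>
      intro x
      rw [pow_succ', mul_apply_eq_comp, cauchyInv_apply]
      refine (h _ _ _ ih x).trans (le_of_eq ?_)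
      rw [show 2 * (n + 1) = 2 * n + 1 + 1 by ring, Nat.factorial_succ, Nat.factorial_succ]
      push_cast
      field_simp
      ring
  refine (norm_le_of_weighted_bound hb0 (by positivity) (hpt n)).trans (le_of_eq ?_)
  rw [mul_pow, ← pow_mul]; ring

end

/-! ### The Neumann series of a quasinilpotent operator -/

section

variable {E : Type*} [NormedAddCommGroup E] [NormedSpace ℂ E]

/-- The Neumann series `(1 - l R)⁻¹ = ∑ lⁿ Rⁿ`. -/
noncomputable def neumannSeries (R : E →L[ℂ] E) (l : ℂ) : E →L[ℂ] E :=
  ∑' n : ℕ, (l • R) ^ n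

variable {R : E →L[ℂ] E} {D : ℝ}

theorem norm_apply_pow_le (h : ∀ n : ℕ, ‖R ^ n‖ ≤ D ^ n / (2 * n).factorial)
    (L : E →L[ℂ] ℂ) (p : E) (n : ℕ) :
    ‖L ((R ^ n) p)‖ ≤ (‖L‖ * ‖p‖) * D ^ n / (2 * n).factorial := by
  calc _ ≤ ‖L‖ * (‖R ^ n‖ * ‖p‖) :=
        (L.le_opNorm _).trans (by gcongr; exact ContinuousLinearMap.le_opNorm _ _)
    _ ≤ ‖L‖ * (D ^ n / (2 * n).factorial * ‖p‖) := by gcongr; exact h n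
    _ = _ := by ring

theorem norm_apply_pow_le' (h : ∀ n : ℕ, ‖R ^ n‖ ≤ D ^ n / (2 * n).factorial) (hD : 0 ≤ D)
    (L : E →L[ℂ] ℂ) (p : E) (n : ℕ) :
    ‖L ((R ^ n) p)‖ ≤ (‖L‖ * ‖p‖) * D ^ n / n.factorial := by
  refine (norm_apply_pow_le h L p n).trans ?_
  gcongr
  omega

variable [CompleteSpace E]

theorem summable_smul_pow (h : ∀ n : ℕ, ‖R ^ n‖ ≤ D ^ n / (2 * n).factorial) (hD : 0 ≤ D) (l : ℂ) :
    Summable fun n : ℕ => (l • R) ^ n := by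
  refine Summable.of_norm_bounded (Real.summable_pow_div_factorial (‖l‖ * D)) fun n => ?_
  rw [smul_pow, norm_smul, norm_pow, mul_pow, mul_div_assoc]
  gcongr
  refine (h n).trans ?_
  gcongr
  omega

theorem neumannSeries_eq (h : ∀ n : ℕ, ‖R ^ n‖ ≤ D ^ n / (2 * n).factorial) (hD : 0 ≤ D) (l : ℂ)
    (p : E) : neumannSeries R l p = p + l • R (neumannSeries R l p) := by
  have := DFunLike.congr_fun (summable_smul_pow h hD l).one_sub_mul_tsum_pow p
  exact sub_eq_iff_eq_add.1 this

theorem eq_zero_of_neumannSeries_eq_zero (h : ∀ n : ℕ, ‖R ^ n‖ ≤ D ^ n / (2 * n).factorial)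
    (hD : 0 ≤ D) {l : ℂ} {p : E} (hp : neumannSeries R l p = 0) : p = 0 := by
  have := neumannSeries_eq h hD l p
  rw [hp] at this
  simpa using this.symm

/-- The expansion of a functional of `(1 - l R)⁻¹ p` in powers of `l`. -/
theorem apply_neumannSeries (h : ∀ n : ℕ, ‖R ^ n‖ ≤ D ^ n / (2 * n).factorial) (hD : 0 ≤ D) (l : ℂ)
    (L : E →L[ℂ] ℂ) (p : E) :
    L (neumannSeries R l p) = ∑' n : ℕ, L ((R ^ n) p) * l ^ n := by
  have := (L.comp (ContinuousLinearMap.apply ℂ E p)).map_tsum (summable_smul_pow h hD l)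
  refine this.trans (tsum_congr fun n => ?_)
  rw [smul_pow, mul_comm]
  exact map_smul L (l ^ n) ((R ^ n) p)

end

/-! ### Completeness of the formal powers -/

section

variable {b M : ℝ} {q f : ℝ → ℂ}

/-- `(1 - l R)⁻¹` turns solutions of `y'' - q y = g` into solutions of `y'' - (q + l) y = g` with the
same Cauchy data at `0`. -/
theorem neumannSeries_cauchySolMap (hb : -b ≤ b) (hc : Continuous f) (h0 : ∀ x, f x ≠ 0) (α β l : ℂ)
    (g : C(Set.Icc (-b) b, ℂ)) :
    neumannSeries (cauchyInv hb hc h0) l (cauchySolMap hb hc h0 α β g)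
      = cauchySolMap hb hc h0 α β
        (g + l • neumannSeries (cauchyInv hb hc h0) l (cauchySolMap hb hc h0 α β g)) := by
  obtain ⟨D, hD, h⟩ := exists_norm_cauchyInv_pow_le hb hc h0
  set Y := neumannSeries (cauchyInv hb hc h0) l (cauchySolMap hb hc h0 α β g) with hY
  have h1 : Y = cauchySolMap hb hc h0 α β g + l • cauchyInv hb hc h0 Y := neumannSeries_eq h hD l _
  have h2 := cauchySolMap_add hb hc h0 α β (l * 0) (l * 0) g (l • Y)
  rw [cauchySolMap_smul] at h2
  simp only [mul_zero, add_zero] at h2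
  rw [h2]
  exact h1

theorem IsNonvanishingSolution.hasSecondDerivAt_neumannSeries (hf : IsNonvanishingSolution b q f)
    (hb : -b ≤ b) (hc : Continuous f) (h0 : ∀ x, f x ≠ 0) (α β l : ℂ) (g : C(Set.Icc (-b) b, ℂ))
    {x : ℝ} (hx : x ∈ Set.Ioo (-b) b) :
    HasSecondDerivAt
      (Set.IccExtend hb (neumannSeries (cauchyInv hb hc h0) l (cauchySolMap hb hc h0 α β g)))
      ((q x + l)
        * Set.IccExtend hb (neumannSeries (cauchyInv hb hc h0) l (cauchySolMap hb hc h0 α β g)) x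
        + Set.IccExtend hb g x) x := by
  have hY := neumannSeries_cauchySolMap hb hc h0 α β l g
  set Y := neumannSeries (cauchyInv hb hc h0) l (cauchySolMap hb hc h0 α β g)
  set w := g + l • Y with hw
  have heq : Set.EqOn (Set.IccExtend hb Y) (cauchySol f α β (Set.IccExtend hb w))
      (Set.Icc (-b) b) := by
    intro y hy
    rw [Set.IccExtend_of_mem hb Y hy]
    exact DFunLike.congr_fun hY ⟨y, hy⟩
  have hx' := Set.Ioo_subset_Icc_self hx
  have h1 := hf.hasSecondDerivAt_cauchySol (α := α) (β := β) hc h0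
    (w.continuous.Icc_extend' (h := hb)) hx
  have h2 := h1.congr_of_eventuallyEq
    (heq.eventuallyEq_of_mem (Icc_mem_nhds hx.1 hx.2))
  rw [← heq hx'] at h2
  convert! h2 using 1
  simp only [Set.IccExtend_of_mem hb _ hx', hw, ContinuousMap.add_apply, ContinuousMap.smul_apply,
    smul_eq_mul]
  ring

theorem IsNonvanishingSolution.norm_neumannSeries_le (hf : IsNonvanishingSolution b q f)
    (hb : -b ≤ b) (hc : Continuous f) (h0 : ∀ x, f x ≠ 0)
    (hq : ∀ x ∈ Set.Icc (-b) b, ‖q x‖ ≤ M) {α β l : ℂ} (hl : M < l.re) {g : C(Set.Icc (-b) b, ℂ)}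
    {m : ℝ} (hg : ‖g‖ ≤ m * (l.re - M))
    (hright : ‖neumannSeries (cauchyInv hb hc h0) l (cauchySolMap hb hc h0 α β g)
      ⟨b, Set.right_mem_Icc.2 hb⟩‖ ≤ m)
    (hleft : ‖neumannSeries (cauchyInv hb hc h0) l (cauchySolMap hb hc h0 α β g)
      ⟨-b, Set.left_mem_Icc.2 hb⟩‖ ≤ m) :
    ‖neumannSeries (cauchyInv hb hc h0) l (cauchySolMap hb hc h0 α β g)‖ ≤ m := by
  have hode := fun x (hx : x ∈ Set.Ioo (-b) b) =>
    hf.hasSecondDerivAt_neumannSeries hb hc h0 α β l g hx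
  set Y := neumannSeries (cauchyInv hb hc h0) l (cauchySolMap hb hc h0 α β g)
  have := norm_le_of_elliptic (m := m) (by linarith) hq hl
    (Y.continuous.Icc_extend' (h := hb)).continuousOn hode
    (fun x _ => (g.norm_coe_le_norm _).trans hg)
    (by rwa [Set.IccExtend_of_mem hb Y (Set.right_mem_Icc.2 hb)])
    (by rwa [Set.IccExtend_of_mem hb Y (Set.left_mem_Icc.2 hb)])
  refine (ContinuousMap.norm_le _ ((norm_nonneg _).trans hright)).2 fun x => ?_
  have h2 := this x x.2
  rwa [Set.IccExtend_of_mem hb Y x.2] at h2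

theorem eq_zero_of_cauchySolMap_eq_zero (hb : 0 < b) (hb' : -b ≤ b) (hc : Continuous f)
    (h0 : ∀ x, f x ≠ 0) {α β : ℂ} (h : cauchySolMap hb' hc h0 α β 0 = 0) : α = 0 ∧ β = 0 := by
  have hzero : (0 : ℝ) ∈ Set.Ioo (-b) b := ⟨by linarith, hb⟩
  have h1 : ∀ x ∈ Set.Icc (-b) b, α + ∫ s in (0 : ℝ)..x, β * (f s ^ 2)⁻¹ = 0 := by
    intro x hx
    have h2 := DFunLike.congr_fun h ⟨x, hx⟩
    change cauchySol f α β (Set.IccExtend hb' (0 : C(Set.Icc (-b) b, ℂ))) x = 0 at h2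
    simpa [cauchySol, Set.IccExtend, h0 x] using h2
  have hα : α = 0 := by simpa using h1 0 (Set.Ioo_subset_Icc_self hzero)
  refine ⟨hα, ?_⟩
  have hcont : Continuous fun s => β * (f s ^ 2)⁻¹ :=
    continuous_const.mul ((hc.pow 2).inv₀ fun x => pow_ne_zero 2 (h0 x))
  have h3 := (hcont.integral_hasStrictDerivAt 0 0).hasDerivAt
  have h4 : (fun x => ∫ s in (0 : ℝ)..x, β * (f s ^ 2)⁻¹) =ᶠ[nhds 0] fun _ => 0 := by
    filter_upwards [Icc_mem_nhds hzero.1 hzero.2] with x hx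
    simpa [hα] using h1 x hx
  have h5 := h3.unique ((hasDerivAt_const (0 : ℝ) (0 : ℂ)).congr_of_eventuallyEq h4)
  simpa [h0 0] using h5

/-- The Dirichlet problem for `y'' - (q + l) y = g` is solvable when `Re l > sup |q|`: uniqueness is
the maximum principle, and the solutions form a two-dimensional affine space. -/
theorem IsNonvanishingSolution.exists_dirichlet (hf : IsNonvanishingSolution b q f)
    (hb : 0 < b) (hb' : -b ≤ b) (hc : Continuous f) (h0 : ∀ x, f x ≠ 0)
    (hq : ∀ x ∈ Set.Icc (-b) b, ‖q x‖ ≤ M) {l : ℂ} (hl : M < l.re) (g : C(Set.Icc (-b) b, ℂ))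
    (u v : ℂ) : ∃ α β : ℂ,
      neumannSeries (cauchyInv hb' hc h0) l (cauchySolMap hb' hc h0 α β g)
        ⟨b, Set.right_mem_Icc.2 hb'⟩ = u ∧
      neumannSeries (cauchyInv hb' hc h0) l (cauchySolMap hb' hc h0 α β g)
        ⟨-b, Set.left_mem_Icc.2 hb'⟩ = v := by
  obtain ⟨D, hD, hpow⟩ := exists_norm_cauchyInv_pow_le hb' hc h0
  set N := neumannSeries (cauchyInv hb' hc h0) l with hN
  set S : ℂ × ℂ →ₗ[ℂ] C(Set.Icc (-b) b, ℂ) :=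
    { toFun := fun p => N (cauchySolMap hb' hc h0 p.1 p.2 0)
      map_add' := fun p p' => by
        rw [← map_add, ← cauchySolMap_add]; simp
      map_smul' := fun c p => by
        have h0' : c • (0 : C(Set.Icc (-b) b, ℂ)) = 0 := by ext x; simp
        rw [RingHom.id_apply, ← map_smul, ← cauchySolMap_smul, h0']
        rfl } with hS
  set B : ℂ × ℂ →ₗ[ℂ] ℂ × ℂ :=
    { toFun := fun p => (S p ⟨b, Set.right_mem_Icc.2 hb'⟩, S p ⟨-b, Set.left_mem_Icc.2 hb'⟩)
      map_add' := fun p p' => by simp only [map_add, ContinuousMap.add_apply, Prod.mk_add_mk]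
      map_smul' := fun c p => by
        simp only [map_smul, ContinuousMap.smul_apply, Prod.smul_mk, RingHom.id_apply] } with hB
  have hinj : Function.Injective B := by
    rw [← LinearMap.ker_eq_bot, LinearMap.ker_eq_bot']
    rintro ⟨α, β⟩ hp
    obtain ⟨h1, h2⟩ := Prod.ext_iff.1 hp
    have h3 := hf.norm_neumannSeries_le hb' hc h0 hq (α := α) (β := β) (m := 0) hl (g := 0)
      (by simp) (norm_le_zero_iff.2 h1) (norm_le_zero_iff.2 h2)
    have h4 := eq_zero_of_neumannSeries_eq_zero hpow hD (norm_le_zero_iff.1 h3)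
    obtain ⟨rfl, rfl⟩ := eq_zero_of_cauchySolMap_eq_zero hb hb' hc h0 h4
    rfl
  obtain ⟨⟨α, β⟩, hp⟩ := LinearMap.injective_iff_surjective.1 hinj
    (u - N (cauchySolMap hb' hc h0 0 0 g) ⟨b, Set.right_mem_Icc.2 hb'⟩,
      v - N (cauchySolMap hb' hc h0 0 0 g) ⟨-b, Set.left_mem_Icc.2 hb'⟩)
  obtain ⟨h1, h2⟩ := Prod.ext_iff.1 hp
  have hsplit : N (cauchySolMap hb' hc h0 α β g)
      = S (α, β) + N (cauchySolMap hb' hc h0 0 0 g) := by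
    change _ = N (cauchySolMap hb' hc h0 α β 0) + _
    rw [← map_add, ← cauchySolMap_add]; simp
  refine ⟨α, β, ?_, ?_⟩
  · rw [hsplit, ContinuousMap.add_apply]; exact eq_sub_iff_add_eq.1 h1
  · rw [hsplit, ContinuousMap.add_apply]; exact eq_sub_iff_add_eq.1 h2

/-- Completeness of the formal powers in `C[-b, b]`, in dual form. For `g` continuous,
`F l = L ((1 - l R)⁻¹ R g)` is entire of order `1/2`, and a Dirichlet solution of
`y'' - (q + l) y = g` may be inserted for `(1 - l R)⁻¹ R g`, since `L` annihilates their difference.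
The maximum principle makes `F` bounded, and `F l → 0`, in a right half-plane, so `F = 0` and
`L (R g) = F 0 = 0`. -/
theorem IsNonvanishingSolution.dual_eq_zero (hf : IsNonvanishingSolution b q f)
    (hb : 0 < b) (hb' : -b ≤ b) (hc : Continuous f) (h0 : ∀ x, f x ≠ 0) (hqc : Continuous q)
    (hq : ∀ x ∈ Set.Icc (-b) b, ‖q x‖ ≤ M) (L : C(Set.Icc (-b) b, ℂ) →L[ℂ] ℂ)
    (hL : ∀ (n : ℕ) (α β : ℂ), L ((cauchyInv hb' hc h0 ^ n) (cauchySolMap hb' hc h0 α β 0)) = 0) :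
    L = 0 := by
  obtain ⟨D, hD, hpow⟩ := exists_norm_cauchyInv_pow_le hb' hc h0
  have hsplit : ∀ (α β : ℂ) (g : C(Set.Icc (-b) b, ℂ)), cauchySolMap hb' hc h0 α β g
      = cauchySolMap hb' hc h0 α β 0 + cauchyInv hb' hc h0 g := by
    intro α β g
    rw [cauchyInv_apply, ← cauchySolMap_add]; simp
  have hres : ∀ g : C(Set.Icc (-b) b, ℂ), L (cauchyInv hb' hc h0 g) = 0 := by
    intro g
    set a : ℕ → ℂ := fun n => L ((cauchyInv hb' hc h0 ^ n) (cauchyInv hb' hc h0 g)) with ha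
    have ha1 : ∀ n, ‖a n‖ ≤ (‖L‖ * ‖cauchyInv hb' hc h0 g‖) * D ^ n / (2 * n).factorial :=
      fun n => norm_apply_pow_le hpow L _ n
    have ha2 : ∀ n, ‖a n‖ ≤ (‖L‖ * ‖cauchyInv hb' hc h0 g‖) * D ^ n / n.factorial :=
      fun n => norm_apply_pow_le' hpow hD L _ n
    have hright : ∀ l : ℂ, M < l.re → ‖∑' n, a n * l ^ n‖ ≤ ‖L‖ * (‖g‖ / (l.re - M)) := by
      intro l hl
      have hpos : 0 < l.re - M := by linarith
      obtain ⟨α, β, h1, h2⟩ := hf.exists_dirichlet hb hb' hc h0 hq hl g 0 0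
      have h3 := hf.norm_neumannSeries_le hb' hc h0 hq (m := ‖g‖ / (l.re - M)) hl (g := g)
        (by rw [div_mul_cancel₀ _ hpos.ne']) (by rw [h1, norm_zero]; positivity)
        (by rw [h2, norm_zero]; positivity)
      have h4 : ∑' n, a n * l ^ n
          = L (neumannSeries (cauchyInv hb' hc h0) l (cauchySolMap hb' hc h0 α β g)) := by
        rw [hsplit, map_add, map_add, apply_neumannSeries hpow hD, apply_neumannSeries hpow hD]
        simp only [hL, ha, zero_mul, tsum_zero, zero_add]
      rw [h4]
      exact (L.le_opNorm _).trans (by gcongr)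
    have hbound : ∀ l : ℂ, ‖∑' n, a n * l ^ n‖ ≤ ‖L‖ * ‖g‖ := by
      refine norm_le_of_bounded_halfPlane (m := M + 1) (differentiable_tsum_mul_pow ha2)
        (Real.sqrt_nonneg D) (by positivity) (norm_tsum_le_exp_sqrt (by positivity) hD ha1) ?_
      intro l hl
      refine (hright l (by linarith)).trans ?_
      gcongr
      exact div_le_self (norm_nonneg _) (by linarith)
    have hcoeff : ∀ n ≠ 0, a n = 0 := fun n hn => coeff_eq_zero_of_bounded ha2 hbound hn
    have hconst : ∀ l : ℂ, ∑' n, a n * l ^ n = a 0 := by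
      intro l
      rw [tsum_eq_single 0 fun n hn => by rw [hcoeff n hn, zero_mul]]
      simp
    have hlim : Filter.Tendsto (fun s : ℝ => ‖L‖ * (‖g‖ / s)) Filter.atTop (nhds (‖L‖ * 0)) :=
      (Filter.Tendsto.div_atTop tendsto_const_nhds Filter.tendsto_id).const_mul _
    rw [mul_zero] at hlim
    have ha0 : ‖a 0‖ ≤ 0 := by
      refine ge_of_tendsto hlim ?_
      filter_upwards [Filter.eventually_gt_atTop 0] with s hs
      have := hright ((M + s : ℝ) : ℂ) (by rw [Complex.ofReal_re]; linarith)
      rwa [hconst, Complex.ofReal_re, add_sub_cancel_left] at this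
    simpa [ha] using norm_le_zero_iff.1 ha0
  have hall : ∀ (α β : ℂ) (g : C(Set.Icc (-b) b, ℂ)), L (cauchySolMap hb' hc h0 α β g) = 0 := by
    intro α β g
    rw [hsplit, map_add, hres, add_zero]
    simpa using hL 0 α β
  refine ContinuousMap.dual_eq_zero_of_forall_pow L
    (fun n => ⟨fun x => ((x : ℝ) : ℂ) ^ n, by fun_prop⟩) (fun _ _ => rfl) fun n => ?_
  set G : C(Set.Icc (-b) b, ℂ) := ⟨fun x => (n : ℂ) * (((n - 1 : ℕ) : ℂ) * ((x : ℝ) : ℂ) ^ (n - 1 - 1))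
    - q x * ((x : ℝ) : ℂ) ^ n, by fun_prop⟩ with hG
  have hder : ∀ (m : ℕ) (x : ℝ), HasDerivAt (fun y : ℝ => (y : ℂ) ^ m)
      ((m : ℂ) * (x : ℂ) ^ (m - 1)) x := fun m x =>
    (((hasDerivAt_id x).ofReal_comp).pow m).congr_deriv (by simp)
  obtain ⟨α, β, hpw⟩ : ∃ α β, Set.EqOn (fun x : ℝ => (x : ℂ) ^ n)
      (cauchySol f α β (Set.IccExtend hb' G)) (Set.Icc (-b) b) :=
    ⟨_, _, hf.eq_cauchySol hb hc h0 (G.continuous.Icc_extend' (h := hb'))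
    (h := fun x : ℝ => (x : ℂ) ^ n) (h' := fun x : ℝ => (n : ℂ) * (x : ℂ) ^ (n - 1))
    (Complex.continuous_ofReal.pow n).continuousOn (fun x _ => hder n x) (fun x hx => by
      refine ((hder (n - 1) x).const_mul (n : ℂ)).congr_deriv ?_
      rw [Set.IccExtend_of_mem hb' G (Set.Ioo_subset_Icc_self hx)]
      simp [hG])⟩
  have hmap : (⟨fun x => ((x : ℝ) : ℂ) ^ n, by fun_prop⟩ : C(Set.Icc (-b) b, ℂ))
      = cauchySolMap hb' hc h0 α β G := by
    ext x
    exact hpw x.2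
  rw [hmap]
  exact hall _ _ _

end

/-! ### Completeness on the parabolic boundary -/

/-- If `W k` is a chain of associated functions of `d²/dx² - q`, then `∑ t^k / k! * W (m - k)` solves
the parabolic equation. -/
theorem exists_hasSecondDerivAt_heat_sum {q : ℝ → ℂ} {W : ℕ → ℝ → ℂ} {x : ℝ}
    (hW0 : HasSecondDerivAt (W 0) (q x * W 0 x) x)
    (hW : ∀ k, HasSecondDerivAt (W (k + 1)) (q x * W (k + 1) x + W k x) x) (m : ℕ) (t : ℝ) :
    ∃ d, HasSecondDerivAt
        (fun y => ∑ k ∈ Finset.range (m + 1), (t : ℂ) ^ k / (k.factorial : ℂ) * W (m - k) y)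
        (q x * (∑ k ∈ Finset.range (m + 1), (t : ℂ) ^ k / (k.factorial : ℂ) * W (m - k) x) + d) x ∧
      HasDerivAt
        (fun s : ℝ => ∑ k ∈ Finset.range (m + 1), (s : ℂ) ^ k / (k.factorial : ℂ) * W (m - k) x) d t := by
  refine ⟨∑ k ∈ Finset.range m, (t : ℂ) ^ k / (k.factorial : ℂ) * W (m - 1 - k) x, ?_, ?_⟩
  · have h1 : HasSecondDerivAt
        (fun y => ∑ k ∈ Finset.range m, (t : ℂ) ^ k / (k.factorial : ℂ) * W (m - k) y)
        (∑ k ∈ Finset.range m, (t : ℂ) ^ k / (k.factorial : ℂ)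
          * (q x * W (m - k) x + W (m - 1 - k) x)) x := by
      refine HasSecondDerivAt.sum _ fun k hk => HasSecondDerivAt.const_mul _ ?_
      have hk' := Finset.mem_range.1 hk
      obtain ⟨j, rfl⟩ : ∃ j, m = k + (j + 1) := ⟨m - k - 1, by omega⟩
      rw [show k + (j + 1) - k = j + 1 by omega, show k + (j + 1) - 1 - k = j by omega]
      exact hW j
    have h2 := h1.add (hW0.const_mul ((t : ℂ) ^ m / (m.factorial : ℂ)))
    simp only [Finset.sum_range_succ, Nat.sub_self]
    convert! h2 using 1
    simp only [mul_add, Finset.sum_add_distrib, Finset.mul_sum]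
    rw [add_right_comm]
    refine congrArg₂ _ (congrArg₂ _ (Finset.sum_congr rfl fun k _ => by ring) rfl) (by ring)
  · have h1 : HasDerivAt (fun s : ℝ => ∑ k ∈ Finset.range (m + 1),
        (s : ℂ) ^ k / (k.factorial : ℂ) * W (m - k) x)
        (∑ k ∈ Finset.range (m + 1), ((k : ℂ) * (t : ℂ) ^ (k - 1)) / (k.factorial : ℂ)
          * W (m - k) x) t := by
      refine HasDerivAt.fun_sum fun k _ => ((HasDerivAt.div_const ?_ _).mul_const _)
      exact (((hasDerivAt_id t).ofReal_comp).pow k).congr_deriv (by simp)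
    refine h1.congr_deriv ?_
    rw [Finset.sum_range_succ']
    simp only [Nat.cast_zero, zero_mul, zero_div, add_zero]
    refine Finset.sum_congr rfl fun k _ => ?_
    have hk : ((k : ℂ) + 1) ≠ 0 := Nat.cast_add_one_ne_zero k
    have hf : (k.factorial : ℂ) ≠ 0 := Nat.cast_ne_zero.2 k.factorial_ne_zero
    rw [show m - (k + 1) = m - 1 - k by omega, Nat.factorial_succ]
    rw [Nat.add_sub_cancel]
    push_cast
    field_simp

section

variable {τ : ℝ}

/-- The function `t ↦ t ^ k / k!` on `[0, τ]`. -/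
noncomputable def powDivFactorial (τ : ℝ) (k : ℕ) : C(Set.Icc 0 τ, ℂ) where
  toFun t := ((t : ℝ) : ℂ) ^ k / (k.factorial : ℂ)
  continuous_toFun := by fun_prop

theorem norm_powDivFactorial_le (hτ : 0 ≤ τ) (k : ℕ) :
    ‖powDivFactorial τ k‖ ≤ τ ^ k / k.factorial := by
  refine (ContinuousMap.norm_le _ (by positivity)).2 fun t => ?_
  change ‖((t : ℝ) : ℂ) ^ k / (k.factorial : ℂ)‖ ≤ _
  rw [norm_div, norm_pow, Complex.norm_real, Real.norm_of_nonneg t.2.1, Complex.norm_natCast]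
  have := t.2.1
  gcongr
  exact t.2.2

theorem norm_apply_powDivFactorial_le (hτ : 0 ≤ τ) (L : C(Set.Icc 0 τ, ℂ) →L[ℂ] ℂ) (k : ℕ) :
    ‖L (powDivFactorial τ k)‖ ≤ ‖L‖ * τ ^ k / k.factorial := by
  refine (L.le_opNorm _).trans ?_
  rw [mul_div_assoc]
  gcongr
  exact norm_powDivFactorial_le hτ k

/-- The series `∑ L (t^k / k!) l^k` is `L` of `exp (l t)`, whose modulus is controlled by `Re l`. -/
theorem norm_tsum_apply_powDivFactorial_le (hτ : 0 ≤ τ) (L : C(Set.Icc 0 τ, ℂ) →L[ℂ] ℂ) {m : ℝ}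
    (hm : 0 ≤ m) {l : ℂ} (hl : l.re ≤ m) :
    ‖∑' k, L (powDivFactorial τ k) * l ^ k‖ ≤ ‖L‖ * Real.exp (m * τ) := by
  have hs : Summable fun k : ℕ => l ^ k • powDivFactorial τ k := by
    refine Summable.of_norm_bounded (Real.summable_pow_div_factorial (‖l‖ * τ)) fun k => ?_
    rw [norm_smul, norm_pow, mul_pow, mul_div_assoc]
    gcongr
    exact norm_powDivFactorial_le hτ k
  have h1 : ∑' k, L (powDivFactorial τ k) * l ^ k = L (∑' k, l ^ k • powDivFactorial τ k) := by
    rw [L.map_tsum hs]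
    refine tsum_congr fun k => ?_
    rw [map_smul, smul_eq_mul, mul_comm]
  rw [h1]
  refine (L.le_opNorm _).trans ?_
  gcongr
  refine (ContinuousMap.norm_le _ (Real.exp_pos _).le).2 fun t => ?_
  have h2 : (∑' k, l ^ k • powDivFactorial τ k) t = Complex.exp (l * (t : ℝ)) := by
    have h3 := (ContinuousMap.evalCLM ℂ t).map_tsum hs
    refine h3.trans ?_
    rw [Complex.exp_eq_exp_ℂ, NormedSpace.exp_eq_tsum_div]
    refine tsum_congr fun k => ?_
    change l ^ k * (((t : ℝ) : ℂ) ^ k / (k.factorial : ℂ)) = _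
    rw [mul_pow, mul_div_assoc]
  rw [h2, Complex.norm_exp, Complex.re_mul_ofReal]
  refine Real.exp_le_exp.2 ?_
  calc l.re * (t : ℝ) ≤ m * t := mul_le_mul_of_nonneg_right hl t.2.1
    _ ≤ m * τ := mul_le_mul_of_nonneg_left t.2.2 hm

end

section

variable {b τ M : ℝ} {q f : ℝ → ℂ}

/-- Completeness on the parabolic boundary, in dual form. A functional on the boundary is split into
its parts `L₀` on the bottom and `L₁`, `L₂` on the lateral sides. If it annihilates all
`∑ t^k / k! * R^(m-k) p`, with `p` in the kernel of `d²/dx² - q`, then for all `l`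
`L₀ y + A l * y b + B l * y (-b) = 0`, where `y = (1 - l R)⁻¹ p`, `A l = L₁ (exp (l t))` and
`B l = L₂ (exp (l t))`. The entire function `A` is bounded: for `Re l` below a bound because
`exp (l t)` is, and for large `Re l` by the choice of `y` with `y b = 1`, `y (-b) = 0`. So `A` is
constant, as is `B`; then `L₁` and `L₂` live at the corners, and completeness of the formal powers
in `C[-b, b]` gives `L₀`. -/
theorem IsNonvanishingSolution.boundary_dual_eq_zero (hf : IsNonvanishingSolution b q f)
    (hb : 0 < b) (hb' : -b ≤ b) (hτ : 0 ≤ τ) (hc : Continuous f) (h0 : ∀ x, f x ≠ 0)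
    (hqc : Continuous q) (hq : ∀ x ∈ Set.Icc (-b) b, ‖q x‖ ≤ M)
    (L₀ : C(Set.Icc (-b) b, ℂ) →L[ℂ] ℂ) (L₁ L₂ : C(Set.Icc 0 τ, ℂ) →L[ℂ] ℂ)
    (hL : ∀ (m : ℕ) (α β : ℂ), L₀ ((cauchyInv hb' hc h0 ^ m) (cauchySolMap hb' hc h0 α β 0))
      + ∑ k ∈ Finset.range (m + 1), L₁ (powDivFactorial τ k)
        * ((cauchyInv hb' hc h0 ^ (m - k)) (cauchySolMap hb' hc h0 α β 0)) ⟨b, Set.right_mem_Icc.2 hb'⟩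
      + ∑ k ∈ Finset.range (m + 1), L₂ (powDivFactorial τ k)
        * ((cauchyInv hb' hc h0 ^ (m - k)) (cauchySolMap hb' hc h0 α β 0)) ⟨-b, Set.left_mem_Icc.2 hb'⟩
      = 0)
    (v₀ : C(Set.Icc (-b) b, ℂ)) (v₁ v₂ : C(Set.Icc 0 τ, ℂ))
    (hv₁ : v₁ ⟨0, Set.left_mem_Icc.2 hτ⟩ = v₀ ⟨b, Set.right_mem_Icc.2 hb'⟩)
    (hv₂ : v₂ ⟨0, Set.left_mem_Icc.2 hτ⟩ = v₀ ⟨-b, Set.left_mem_Icc.2 hb'⟩) :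
    L₀ v₀ + L₁ v₁ + L₂ v₂ = 0 := by
  obtain ⟨D, hD, hpow⟩ := exists_norm_cauchyInv_pow_le hb' hc h0
  have hM : 0 ≤ M := (norm_nonneg _).trans (hq b (Set.right_mem_Icc.2 hb'))
  set R := cauchyInv hb' hc h0 with hR
  set r : Set.Icc (-b) b := ⟨b, Set.right_mem_Icc.2 hb'⟩ with hr
  set s : Set.Icc (-b) b := ⟨-b, Set.left_mem_Icc.2 hb'⟩ with hs
  set o : Set.Icc 0 τ := ⟨0, Set.left_mem_Icc.2 hτ⟩ with ho
  set A : ℂ → ℂ := fun l => ∑' k, L₁ (powDivFactorial τ k) * l ^ k with hA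
  set B : ℂ → ℂ := fun l => ∑' k, L₂ (powDivFactorial τ k) * l ^ k with hB
  have hident : ∀ (l α β : ℂ), L₀ (neumannSeries R l (cauchySolMap hb' hc h0 α β 0))
      + A l * (neumannSeries R l (cauchySolMap hb' hc h0 α β 0)) r
      + B l * (neumannSeries R l (cauchySolMap hb' hc h0 α β 0)) s = 0 := by
    intro l α β
    set p := cauchySolMap hb' hc h0 α β 0 with hp
    have hprod : ∀ (L : C(Set.Icc 0 τ, ℂ) →L[ℂ] ℂ) (x : Set.Icc (-b) b),
        HasSum (fun m => (∑ k ∈ Finset.range (m + 1),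
          L (powDivFactorial τ k) * ((R ^ (m - k)) p) x) * l ^ m)
          ((∑' k, L (powDivFactorial τ k) * l ^ k) * (neumannSeries R l p) x) := by
      intro L x
      have h1 := summable_norm_mul_pow (norm_apply_powDivFactorial_le hτ L) l
      have h2 := summable_norm_mul_pow (norm_apply_pow_le' hpow hD (ContinuousMap.evalCLM ℂ x) p) l
      have h3 := hasSum_sum_range_mul_of_summable_norm h1 h2
      rw [← apply_neumannSeries hpow hD] at h3
      refine h3.congr_fun ?_
      intro m
      rw [Finset.sum_mul]
      refine Finset.sum_congr rfl fun k hk => ?_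
      have hkm : k ≤ m := Nat.lt_succ_iff.1 (Finset.mem_range.1 hk)
      rw [← Nat.add_sub_of_le hkm, pow_add, Nat.add_sub_cancel_left]
      simp only [ContinuousMap.evalCLM_apply]
      ring
    have hbot : HasSum (fun m => L₀ ((R ^ m) p) * l ^ m) (L₀ (neumannSeries R l p)) := by
      rw [apply_neumannSeries hpow hD]
      exact (summable_norm_mul_pow (norm_apply_pow_le' hpow hD L₀ p) l).of_norm.hasSum
    have hsum := (hbot.add (hprod L₁ r)).add (hprod L₂ s)
    refine hsum.unique ?_
    convert! (hasSum_zero (α := ℂ) (β := ℕ)) using 2 with m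
    rw [← add_mul, ← add_mul, hL m α β, zero_mul]
  have hAB : ∀ l : ℂ, M < l.re → ‖A l‖ ≤ ‖L₀‖ ∧ ‖B l‖ ≤ ‖L₀‖ := by
    intro l hl
    have hle : ∀ (α β u v : ℂ), ‖u‖ ≤ 1 → ‖v‖ ≤ 1 →
        (neumannSeries R l (cauchySolMap hb' hc h0 α β 0)) r = u →
        (neumannSeries R l (cauchySolMap hb' hc h0 α β 0)) s = v →
        ‖L₀ (neumannSeries R l (cauchySolMap hb' hc h0 α β 0))‖ ≤ ‖L₀‖ := by
      intro α β u v hu hv h1 h2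
      have h3 := hf.norm_neumannSeries_le hb' hc h0 hq (α := α) (β := β) (m := 1) hl (g := 0)
        (by rw [norm_zero]; linarith) (by rw [← hR, ← hr, h1]; exact hu)
        (by rw [← hR, ← hs, h2]; exact hv)
      exact (L₀.le_opNorm _).trans (mul_le_of_le_one_right (norm_nonneg _) h3)
    constructor
    · obtain ⟨α, β, h1, h2⟩ := hf.exists_dirichlet hb hb' hc h0 hq hl 0 1 0
      have h3 := hident l α β
      rw [h1, h2, mul_one, mul_zero, add_zero] at h3
      rw [eq_neg_of_add_eq_zero_right h3, norm_neg]
      exact hle α β 1 0 (by simp) (by simp) h1 h2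
    · obtain ⟨α, β, h1, h2⟩ := hf.exists_dirichlet hb hb' hc h0 hq hl 0 0 1
      have h3 := hident l α β
      rw [h1, h2, mul_one, mul_zero, add_zero] at h3
      rw [eq_neg_of_add_eq_zero_right h3, norm_neg]
      exact hle α β 0 1 (by simp) (by simp) h1 h2
  have hcoeff : ∀ L : C(Set.Icc 0 τ, ℂ) →L[ℂ] ℂ,
      (∀ l : ℂ, M < l.re → ‖∑' k, L (powDivFactorial τ k) * l ^ k‖ ≤ ‖L₀‖) →
      ∀ k ≠ 0, L (powDivFactorial τ k) = 0 := by
    intro L hLl k hk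
    refine coeff_eq_zero_of_bounded (norm_apply_powDivFactorial_le hτ L)
      (B := max ‖L₀‖ (‖L‖ * Real.exp (M * τ))) (fun l => ?_) hk
    rcases lt_or_ge M l.re with h | h
    · exact (hLl l h).trans (le_max_left _ _)
    · exact (norm_tsum_apply_powDivFactorial_le hτ L hM h).trans (le_max_right _ _)
  have hL₁ := hcoeff L₁ fun l hl => (hAB l hl).1
  have hL₂ := hcoeff L₂ fun l hl => (hAB l hl).2
  have hcorner : ∀ L : C(Set.Icc 0 τ, ℂ) →L[ℂ] ℂ, (∀ k ≠ 0, L (powDivFactorial τ k) = 0) →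
      ∀ v, L v = L (powDivFactorial τ 0) * v o := by
    intro L hLk v
    have h1 : L - L (powDivFactorial τ 0) • ContinuousMap.evalCLM ℂ o = 0 := by
      refine ContinuousMap.dual_eq_zero_of_forall_pow _
        (fun n => (n.factorial : ℂ) • powDivFactorial τ n) (fun n x => ?_) fun n => ?_
      · change (n.factorial : ℂ) * (((x : ℝ) : ℂ) ^ n / (n.factorial : ℂ)) = _
        exact mul_div_cancel₀ _ (Nat.cast_ne_zero.2 n.factorial_ne_zero)
      · rw [map_smul]
        refine smul_eq_zero_of_right _ ?_
        change L (powDivFactorial τ n) - L (powDivFactorial τ 0) * powDivFactorial τ n o = 0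
        rcases eq_or_ne n 0 with rfl | hn
        · simp [powDivFactorial]
        · rw [hLk n hn]
          simp [powDivFactorial, ho, hn]
    exact sub_eq_zero.1 (DFunLike.congr_fun h1 v)
  set c₁ := L₁ (powDivFactorial τ 0) with hc₁
  set c₂ := L₂ (powDivFactorial τ 0) with hc₂
  have hL₀ : L₀ + c₁ • ContinuousMap.evalCLM ℂ r + c₂ • ContinuousMap.evalCLM ℂ s = 0 := by
    refine hf.dual_eq_zero hb hb' hc h0 hqc hq _ fun m α β => ?_
    have h1 := hL m α β
    rw [Finset.sum_eq_single_of_mem 0 (by simp) (fun k _ hk => by rw [hL₁ k hk, zero_mul]),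
      Finset.sum_eq_single_of_mem 0 (by simp) (fun k _ hk => by rw [hL₂ k hk, zero_mul])] at h1
    exact h1
  have h2 : L₀ v₀ + c₁ * v₀ r + c₂ * v₀ s = 0 := DFunLike.congr_fun hL₀ v₀
  rw [hcorner L₁ hL₁ v₁, hcorner L₂ hL₂ v₂, hv₁, hv₂]
  exact h2

end

/-! ### Transmuted heat polynomials -/

section

variable {b τ M : ℝ} {q f : ℝ → ℂ}

theorem formalPower_congr {f' : ℝ → ℂ} (hff : Set.EqOn f f' (Set.Icc (-b) b)) (k : ℕ) :
    Set.EqOn (formalPower f k) (formalPower f' k) (Set.Icc (-b) b) := by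
  induction k using Nat.twoStepInduction with
  | zero =>
    rw [formalPower_zero, formalPower_zero]
    exact cauchySol_congr hff (fun _ _ => rfl) 1 0
  | one =>
    rw [formalPower_one, formalPower_one]
    exact cauchySol_congr hff (fun _ _ => rfl) 0 1
  | more k ih _ =>
    intro x hx
    rw [formalPower_add_two, formalPower_add_two, cauchySol_congr hff ih 0 0 hx]

theorem transmutedHeatPoly_congr {f' : ℝ → ℂ} (hff : Set.EqOn f f' (Set.Icc (-b) b)) (n : ℕ)
    {x : ℝ} (hx : x ∈ Set.Icc (-b) b) (t : ℝ) :
    transmutedHeatPoly f n x t = transmutedHeatPoly f' n x t := by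
  simp only [transmutedHeatPoly, formalPower_congr hff _ hx]

theorem continuous_transmutedHeatPoly (hc : Continuous f) (h0 : ∀ x, f x ≠ 0) (n : ℕ) :
    Continuous fun p : ℝ × ℝ => transmutedHeatPoly f n p.1 p.2 := by
  have h := continuous_formalPower hc h0
  unfold transmutedHeatPoly
  exact continuous_const.mul (continuous_finsetSum _ fun k _ =>
    ((by fun_prop : Continuous fun p : ℝ × ℝ => (p.2 : ℂ) ^ k).mul
      ((h _).comp continuous_fst)).div_const _)

/-- The transmuted heat polynomials of one parity, in terms of the chain `φ_{2k+j} / (2k+j)!`. -/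
theorem transmutedHeatPoly_eq (f : ℝ → ℂ) (m : ℕ) {j : ℕ} (hj : j < 2) (x t : ℝ) :
    transmutedHeatPoly f (2 * m + j) x t = ((2 * m + j).factorial : ℂ)
      * ∑ k ∈ Finset.range (m + 1), (t : ℂ) ^ k / (k.factorial : ℂ)
        * (formalPower f (2 * (m - k) + j) x / ((2 * (m - k) + j).factorial : ℂ)) := by
  rw [transmutedHeatPoly, show (2 * m + j) / 2 = m by omega]
  congr 1
  refine Finset.sum_congr rfl fun k hk => ?_
  have hk' := Finset.mem_range.1 hk
  rw [show 2 * m + j - 2 * k = 2 * (m - k) + j by omega, mul_div_mul_comm]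

theorem formalPower_div_factorial_add_two (f : ℝ → ℂ) (n : ℕ) (x : ℝ) :
    formalPower f (n + 2) x / ((n + 2).factorial : ℂ)
      = cauchySol f 0 0 (fun y => formalPower f n y / (n.factorial : ℂ)) x := by
  have h := cauchySol_const_mul f (formalPower f n) (n.factorial : ℂ)⁻¹ 0 0 x
  simp only [mul_zero] at h
  simp only [div_eq_inv_mul]
  rw [h, formalPower_add_two, Nat.factorial_succ, Nat.factorial_succ]
  have h1 : (n.factorial : ℂ) ≠ 0 := Nat.cast_ne_zero.2 n.factorial_ne_zero
  have h2 : ((n : ℂ) + 1) ≠ 0 := Nat.cast_add_one_ne_zero n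
  have h3 : ((n : ℂ) + 1 + 1) ≠ 0 := by exact_mod_cast Nat.succ_ne_zero (n + 1)
  push_cast
  rw [show (n : ℂ) + 2 = n + 1 + 1 by ring]
  field_simp

theorem IsNonvanishingSolution.exists_hasSecondDerivAt_transmutedHeatPoly
    (hf : IsNonvanishingSolution b q f) (hc : Continuous f) (h0 : ∀ x, f x ≠ 0) (n : ℕ) {x : ℝ}
    (hx : x ∈ Set.Ioo (-b) b) (t : ℝ) :
    ∃ d, HasSecondDerivAt (fun y => transmutedHeatPoly f n y t)
        (q x * transmutedHeatPoly f n x t + d) x ∧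
      HasDerivAt (fun s => transmutedHeatPoly f n x s) d t := by
  obtain ⟨m, j, hj, rfl⟩ : ∃ m j, j < 2 ∧ n = 2 * m + j :=
    ⟨n / 2, n % 2, Nat.mod_lt _ (by norm_num), by omega⟩
  set W : ℕ → ℝ → ℂ := fun k y => formalPower f (2 * k + j) y / ((2 * k + j).factorial : ℂ) with hW
  have hW0 : HasSecondDerivAt (W 0) (q x * W 0 x) x := by
    have h1 : ∃ α β, W 0 = cauchySol f α β fun _ => 0 := by
      interval_cases j
      · exact ⟨1, 0, by rw [← formalPower_zero]; ext y; simp [hW]⟩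
      · exact ⟨0, 1, by rw [← formalPower_one]; ext y; simp [hW]⟩
    obtain ⟨α, β, h1⟩ := h1
    rw [h1]
    simpa using hf.hasSecondDerivAt_cauchySol (g := fun _ => 0) (α := α) (β := β) hc h0
      continuous_const hx
  have hW1 : ∀ k, HasSecondDerivAt (W (k + 1)) (q x * W (k + 1) x + W k x) x := by
    intro k
    have h1 : W (k + 1) = cauchySol f 0 0 (W k) := by
      ext y
      simp only [hW, show 2 * (k + 1) + j = 2 * k + j + 2 by ring]
      exact formalPower_div_factorial_add_two f (2 * k + j) y
    rw [h1]
    exact hf.hasSecondDerivAt_cauchySol hc h0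
      ((continuous_formalPower hc h0 _).div_const _) hx
  obtain ⟨d, hd1, hd2⟩ := exists_hasSecondDerivAt_heat_sum hW0 hW1 m t
  simp only [transmutedHeatPoly_eq f m hj]
  refine ⟨((2 * m + j).factorial : ℂ) * d, ?_, hd2.const_mul _⟩
  convert! hd1.const_mul ((2 * m + j).factorial : ℂ) using 1
  ring

theorem cauchyInv_pow_apply (hb : -b ≤ b) (hc : Continuous f) (h0 : ∀ x, f x ≠ 0) {j : ℕ}
    {p : C(Set.Icc (-b) b, ℂ)} (hp : ∀ x, p x = formalPower f j x / (j.factorial : ℂ)) (m : ℕ)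
    (x : Set.Icc (-b) b) :
    ((cauchyInv hb hc h0 ^ m) p) x
      = formalPower f (2 * m + j) x / ((2 * m + j).factorial : ℂ) := by
  induction m generalizing x with
  | zero => rw [pow_zero, mul_zero, zero_add]; exact hp x
  | succ m ih =>
    rw [pow_succ', show 2 * (m + 1) + j = 2 * m + j + 2 by ring, formalPower_div_factorial_add_two]
    refine cauchySol_congr (fun _ _ => rfl) (fun y hy => ?_) 0 0 x.2
    rw [Set.IccExtend_of_mem hb _ hy]
    exact ih ⟨y, hy⟩

/-- The restriction of `u_n` to the bottom and the lateral sides of the rectangle. -/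
noncomputable def boundaryValues (b τ : ℝ) (hc : Continuous f) (h0 : ∀ x, f x ≠ 0) (n : ℕ) :
    C(Set.Icc (-b) b, ℂ) × C(Set.Icc 0 τ, ℂ) × C(Set.Icc 0 τ, ℂ) :=
  let U : C(ℝ × ℝ, ℂ) := ⟨_, continuous_transmutedHeatPoly hc h0 n⟩
  (U.comp ⟨fun x => ((x : ℝ), (0 : ℝ)), by fun_prop⟩,
    U.comp ⟨fun t => (b, (t : ℝ)), by fun_prop⟩, U.comp ⟨fun t => (-b, (t : ℝ)), by fun_prop⟩)

/-- The boundary values of the transmuted heat polynomials are dense in the continuous functions on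
the parabolic boundary. -/
theorem IsNonvanishingSolution.mem_closure_span_boundaryValues (hf : IsNonvanishingSolution b q f)
    (hb : 0 < b) (hb' : -b ≤ b) (hτ : 0 ≤ τ) (hc : Continuous f) (h0 : ∀ x, f x ≠ 0)
    (hqc : Continuous q) (v₀ : C(Set.Icc (-b) b, ℂ)) (v₁ v₂ : C(Set.Icc 0 τ, ℂ))
    (hv₁ : v₁ ⟨0, Set.left_mem_Icc.2 hτ⟩ = v₀ ⟨b, Set.right_mem_Icc.2 hb'⟩)
    (hv₂ : v₂ ⟨0, Set.left_mem_Icc.2 hτ⟩ = v₀ ⟨-b, Set.left_mem_Icc.2 hb'⟩) :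
    (v₀, v₁, v₂) ∈ (Submodule.span ℂ (Set.range
      (boundaryValues b τ hc h0))).topologicalClosure := by
  obtain ⟨M, -, hq⟩ := exists_norm_le_of_continuous (b := b) hqc
  refine Submodule.mem_topologicalClosure_of_forall_dual _ fun L hL => ?_
  set L₀ : C(Set.Icc (-b) b, ℂ) →L[ℂ] ℂ := L.comp (ContinuousLinearMap.inl ℂ _ _) with hL₀
  set L₁ : C(Set.Icc 0 τ, ℂ) →L[ℂ] ℂ :=
    (L.comp (ContinuousLinearMap.inr ℂ _ _)).comp (ContinuousLinearMap.inl ℂ _ _) with hL₁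
  set L₂ : C(Set.Icc 0 τ, ℂ) →L[ℂ] ℂ :=
    (L.comp (ContinuousLinearMap.inr ℂ _ _)).comp (ContinuousLinearMap.inr ℂ _ _) with hL₂
  have hsplit : ∀ w₀ w₁ w₂, L (w₀, w₁, w₂) = L₀ w₀ + L₁ w₁ + L₂ w₂ := by
    intro w₀ w₁ w₂
    simp only [hL₀, hL₁, hL₂, ContinuousLinearMap.comp_apply, ContinuousLinearMap.inl_apply,
      ContinuousLinearMap.inr_apply, ← map_add]
    simp
  rw [hsplit]
  refine hf.boundary_dual_eq_zero hb hb' hτ hc h0 hqc hq L₀ L₁ L₂ ?_ v₀ v₁ v₂ hv₁ hv₂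
  have hzero : ∀ n, L (boundaryValues b τ hc h0 n) = 0 := fun n =>
    hL _ (Submodule.subset_span ⟨n, rfl⟩)
  -- the relation for `φ_0` and `φ_1`
  have hbase : ∀ (j : ℕ) (p : C(Set.Icc (-b) b, ℂ)), j < 2 →
      (∀ x, p x = formalPower f j x / (j.factorial : ℂ)) → ∀ m : ℕ,
      L₀ ((cauchyInv hb' hc h0 ^ m) p)
      + ∑ k ∈ Finset.range (m + 1), L₁ (powDivFactorial τ k)
        * ((cauchyInv hb' hc h0 ^ (m - k)) p) ⟨b, Set.right_mem_Icc.2 hb'⟩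
      + ∑ k ∈ Finset.range (m + 1), L₂ (powDivFactorial τ k)
        * ((cauchyInv hb' hc h0 ^ (m - k)) p) ⟨-b, Set.left_mem_Icc.2 hb'⟩ = 0 := by
    intro j p hj hp m
    have hR := cauchyInv_pow_apply hb' hc h0 hp
    set N : ℂ := ((2 * m + j).factorial : ℂ) with hN
    have hside : ∀ (x : Set.Icc (-b) b) (w : C(Set.Icc 0 τ, ℂ)),
        (∀ t, w t = transmutedHeatPoly f (2 * m + j) x t) →
        w = N • ∑ k ∈ Finset.range (m + 1),
          ((cauchyInv hb' hc h0 ^ (m - k)) p) x • powDivFactorial τ k := by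
      intro x w hw
      ext t
      rw [hw, transmutedHeatPoly_eq f m hj]
      simp only [ContinuousMap.smul_apply, ContinuousMap.sum_apply, smul_eq_mul, hR]
      congr 1
      refine Finset.sum_congr rfl fun k _ => ?_
      rw [mul_comm]
      rfl
    have hmap : ∀ (L' : C(Set.Icc 0 τ, ℂ) →L[ℂ] ℂ) (x : Set.Icc (-b) b),
        L' (N • ∑ k ∈ Finset.range (m + 1),
          ((cauchyInv hb' hc h0 ^ (m - k)) p) x • powDivFactorial τ k)
        = N * ∑ k ∈ Finset.range (m + 1), L' (powDivFactorial τ k)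
          * ((cauchyInv hb' hc h0 ^ (m - k)) p) x := by
      intro L' x
      rw [map_smul, map_sum, smul_eq_mul]
      congr 1
      refine Finset.sum_congr rfl fun k _ => ?_
      rw [map_smul, smul_eq_mul, mul_comm]
    have hbot : ∀ w : C(Set.Icc (-b) b, ℂ),
        (∀ x : Set.Icc (-b) b, w x = transmutedHeatPoly f (2 * m + j) x 0) →
        w = N • (cauchyInv hb' hc h0 ^ m) p := by
      intro w hw
      ext x
      rw [hw, transmutedHeatPoly_eq f m hj, ContinuousMap.smul_apply, smul_eq_mul, hR,
        Finset.sum_eq_single_of_mem 0 (by simp) (fun k _ hk => by simp [hk])]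
      simp [hN]
    set w := boundaryValues b τ hc h0 (2 * m + j) with hw
    have e₀ := hbot w.1 fun _ => rfl
    have e₁ := hside ⟨b, Set.right_mem_Icc.2 hb'⟩ w.2.1 fun _ => rfl
    have e₂ := hside ⟨-b, Set.left_mem_Icc.2 hb'⟩ w.2.2 fun _ => rfl
    have h1 : L (w.1, w.2.1, w.2.2) = 0 := hzero (2 * m + j)
    rw [hsplit, e₀, e₁, e₂, hmap, hmap, map_smul, smul_eq_mul,
      ← mul_add, ← mul_add] at h1
    exact (mul_eq_zero.1 h1).resolve_left (Nat.cast_ne_zero.2 (Nat.factorial_ne_zero _))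
  intro m α β
  have hlin : cauchySolMap hb' hc h0 α β 0
      = α • cauchySolMap hb' hc h0 1 0 0 + β • cauchySolMap hb' hc h0 0 1 0 := by
    rw [← cauchySolMap_smul, ← cauchySolMap_smul, ← cauchySolMap_add]
    congr 1
    · simp
    · simp
    · ext x; simp
  have h1 := hbase 0 (cauchySolMap hb' hc h0 1 0 0) (by norm_num)
    (fun x => by rw [formalPower_zero]; simp; rfl) m
  have h2 := hbase 1 (cauchySolMap hb' hc h0 0 1 0) (by norm_num)
    (fun x => by rw [formalPower_one]; simp; rfl) m
  rw [hlin]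
  simp only [map_add, map_smul, ContinuousMap.add_apply, ContinuousMap.smul_apply, smul_eq_mul,
    mul_add, Finset.sum_add_distrib, mul_left_comm _ α, mul_left_comm _ β, ← Finset.mul_sum]
  linear_combination α * h1 + β * h2

/-- Approximation by transmuted heat polynomials: on the parabolic boundary by density, in the
rectangle by the maximum principle. -/
theorem IsNonvanishingSolution.exists_approx (hf : IsNonvanishingSolution b q f)
    (hb : 0 < b) (hτ : 0 < τ) (hc : Continuous f) (h0 : ∀ x, f x ≠ 0)
    (hqc : Continuous q) {u : ℝ → ℝ → ℂ}
    (hu : ContinuousOn (fun p : ℝ × ℝ => u p.1 p.2) (Set.Icc (-b) b ×ˢ Set.Icc 0 τ))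
    (hsol : IsSolution b τ q u) {ε : ℝ} (hε : 0 < ε) :
    ∃ (N : ℕ) (a : ℕ → ℂ), ∀ x ∈ Set.Icc (-b) b, ∀ t ∈ Set.Icc 0 τ,
      ‖u x t - ∑ n ∈ Finset.range (N + 1), a n * transmutedHeatPoly f n x t‖ < ε := by
  have hb' : -b ≤ b := by linarith
  obtain ⟨M, hM, hq⟩ := exists_norm_le_of_continuous (b := b) hqc
  have hrb : b ∈ Set.Icc (-b) b := Set.right_mem_Icc.2 hb'
  have hlb : -b ∈ Set.Icc (-b) b := Set.left_mem_Icc.2 hb'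
  have ho : (0 : ℝ) ∈ Set.Icc 0 τ := Set.left_mem_Icc.2 hτ.le
  set v₀ : C(Set.Icc (-b) b, ℂ) := ⟨fun x => u x 0, hu.comp_continuous
    (f := fun x : Set.Icc (-b) b => ((x : ℝ), (0 : ℝ))) (by fun_prop) fun x => ⟨x.2, ho⟩⟩ with hv₀
  set v₁ : C(Set.Icc 0 τ, ℂ) := ⟨fun t => u b t, hu.comp_continuous
    (f := fun t : Set.Icc 0 τ => (b, (t : ℝ))) (by fun_prop) fun t => ⟨hrb, t.2⟩⟩ with hv₁
  set v₂ : C(Set.Icc 0 τ, ℂ) := ⟨fun t => u (-b) t, hu.comp_continuous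
    (f := fun t : Set.Icc 0 τ => (-b, (t : ℝ))) (by fun_prop) fun t => ⟨hlb, t.2⟩⟩ with hv₂
  set δ : ℝ := ε / 2 * Real.exp (-((M + 1) * τ)) with hδ
  have hδ0 : 0 < δ := by positivity
  obtain ⟨w, hw, hdist⟩ := Metric.mem_closure_iff.1
    (hf.mem_closure_span_boundaryValues hb hb' hτ.le hc h0 hqc v₀ v₁ v₂ rfl rfl) δ hδ0
  obtain ⟨c, rfl⟩ := (Finsupp.mem_span_range_iff_exists_finsupp).1 hw
  set N := c.support.sup id with hN
  have hsum : c.sum (fun n a => a • boundaryValues b τ hc h0 n)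
      = ∑ n ∈ Finset.range (N + 1), c n • boundaryValues b τ hc h0 n := by
    refine Finsupp.sum_of_support_subset _ (fun n hn => ?_) _ (fun n _ => ?_)
    · exact Finset.mem_range.2 (Nat.lt_succ_of_le (Finset.le_sup (f := id) hn))
    · refine Prod.ext ?_ (Prod.ext ?_ ?_) <;> ext x <;> simp
  rw [hsum, dist_eq_norm] at hdist
  refine ⟨N, c, ?_⟩
  set P : ℝ → ℝ → ℂ := fun x t => ∑ n ∈ Finset.range (N + 1), c n * transmutedHeatPoly f n x t
    with hP
  have hPc : Continuous fun p : ℝ × ℝ => P p.1 p.2 :=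
    continuous_finsetSum _ fun n _ => continuous_const.mul (continuous_transmutedHeatPoly hc h0 n)
  have hbottom : ∀ x ∈ Set.Icc (-b) b, ‖u x 0 - P x 0‖ ≤ δ := by
    intro x hx
    refine le_trans ?_ hdist.le
    refine le_trans (le_of_eq ?_) ((ContinuousMap.norm_coe_le_norm _ ⟨x, hx⟩).trans (norm_fst_le _))
    simp only [hP, Prod.fst_sub, Prod.fst_sum, Prod.smul_fst, ContinuousMap.sub_apply,
      ContinuousMap.sum_apply, ContinuousMap.smul_apply, smul_eq_mul]
    rfl
  have hright : ∀ t ∈ Set.Icc 0 τ, ‖u b t - P b t‖ ≤ δ := by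
    intro t ht
    refine le_trans ?_ hdist.le
    refine le_trans (le_of_eq ?_) ((ContinuousMap.norm_coe_le_norm _ ⟨t, ht⟩).trans
      ((norm_fst_le _).trans (norm_snd_le _)))
    simp only [hP, Prod.fst_sub, Prod.fst_sum, Prod.smul_fst, Prod.snd_sub, Prod.snd_sum,
      Prod.smul_snd, ContinuousMap.sub_apply,
      ContinuousMap.sum_apply, ContinuousMap.smul_apply, smul_eq_mul]
    rfl
  have hleft : ∀ t ∈ Set.Icc 0 τ, ‖u (-b) t - P (-b) t‖ ≤ δ := by
    intro t ht
    refine le_trans ?_ hdist.le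
    refine le_trans (le_of_eq ?_) ((ContinuousMap.norm_coe_le_norm _ ⟨t, ht⟩).trans
      ((norm_snd_le _).trans (norm_snd_le _)))
    simp only [hP, Prod.snd_sub, Prod.snd_sum,
      Prod.smul_snd, ContinuousMap.sub_apply,
      ContinuousMap.sum_apply, ContinuousMap.smul_apply, smul_eq_mul]
    rfl
  have hpde : ∀ x ∈ Set.Ioo (-b) b, ∀ t ∈ Set.Ioo 0 τ, ∃ d,
      HasSecondDerivAt (fun y => u y t - P y t) (q x * (u x t - P x t) + d) x ∧
        HasDerivAt (fun s => u x s - P x s) d t := by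
    intro x hx t ht
    choose d hd using fun n => hf.exists_hasSecondDerivAt_transmutedHeatPoly hc h0 n hx t
    obtain ⟨-, h2, h3, h4⟩ := hsol x hx t ht
    have hu2 : HasSecondDerivAt (fun y => u y t) (deriv (deriv fun y => u y t) x) x :=
      HasSecondDerivAt.of_deriv (by
        filter_upwards [Ioo_mem_nhds hx.1 hx.2] with y hy using (hsol y hy t ht).1) h2
    have hP2 := HasSecondDerivAt.sum (Finset.range (N + 1)) fun n _ => (hd n).1.const_mul (c n)
    have hP1 : HasDerivAt (fun s => P x s) (∑ n ∈ Finset.range (N + 1), c n * d n) t :=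
      HasDerivAt.fun_sum fun n _ => (hd n).2.const_mul (c n)
    refine ⟨deriv (fun s => u x s) t - ∑ n ∈ Finset.range (N + 1), c n * d n, ?_,
      h3.hasDerivAt.sub hP1⟩
    convert! hu2.sub hP2 using 1
    rw [← h4]
    simp only [hP, mul_add, Finset.sum_add_distrib, mul_left_comm (c _) (q x), ← Finset.mul_sum]
    ring
  have hmain := norm_le_of_parabolic (v := fun x t => u x t - P x t) hτ hq
    (hu.sub hPc.continuousOn) hpde hbottom hright hleft
  intro x hx t ht
  calc ‖u x t - P x t‖ ≤ δ * Real.exp ((M + 1) * t) := hmain x hx t ht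
    _ ≤ δ * Real.exp ((M + 1) * τ) := by gcongr; exact ht.2
    _ = ε / 2 := by rw [hδ, mul_assoc, ← Real.exp_add]; simp
    _ < ε := by linarith

/-- The notion depends only on the values of `q` and `f` on `[-b, b]`. -/
theorem IsNonvanishingSolution.congr (hb : 0 < b) (hf : IsNonvanishingSolution b q f)
    {q' f' : ℝ → ℂ} (hqq : Set.EqOn q q' (Set.Icc (-b) b)) (hff : Set.EqOn f f' (Set.Icc (-b) b)) :
    IsNonvanishingSolution b q' f' := by
  have hev : ∀ x ∈ Set.Ioo (-b) b, f' =ᶠ[nhds x] f := fun x hx =>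
    hff.symm.eventuallyEq_of_mem (Icc_mem_nhds hx.1 hx.2)
  refine ⟨hf.continuousOn.congr hff.symm, fun x hx => ?_, fun x hx => ?_, fun x hx => ?_,
    fun x hx => ?_, ?_⟩
  · exact (hf.differentiableAt x hx).congr_of_eventuallyEq (hev x hx)
  · exact (hf.differentiableAt_deriv x hx).congr_of_eventuallyEq (hev x hx).deriv
  · have hx' := Set.Ioo_subset_Icc_self hx
    rw [(hev x hx).deriv.deriv_eq, ← hqq hx', ← hff hx']
    exact hf.equation x hx
  · rw [← hff hx]; exact hf.ne_zero x hx
  · rw [← hff ⟨by linarith, hb.le⟩]; exact hf.map_zero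

end

theorem theorem1 (b τ : ℝ) (hb : 0 < b) (hτ : 0 < τ)
    (q : ℝ → ℂ) (hq : ContinuousOn q (Set.Icc (-b) b))
    (f : ℝ → ℂ) (hf : IsNonvanishingSolution b q f) :
    (∀ K : ℝ → ℝ → ℂ, IsTransmutationKernel b q f K →
      ∀ (n : ℕ), ∀ x ∈ Set.Icc (-b) b, ∀ t : ℝ,
        volterra K (fun y => heatPoly n y t) x = transmutedHeatPoly f n x t) ∧
    (∀ u : ℝ → ℝ → ℂ,
      ContinuousOn (fun p : ℝ × ℝ => u p.1 p.2) (Set.Icc (-b) b ×ˢ Set.Icc 0 τ) →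
      IsSolution b τ q u →
      ∀ ε : ℝ, 0 < ε → ∃ (N : ℕ) (a : ℕ → ℂ),
        ∀ x ∈ Set.Icc (-b) b, ∀ t ∈ Set.Icc 0 τ,
          ‖u x t - ∑ n ∈ Finset.range (N + 1), a n * transmutedHeatPoly f n x t‖ < ε) := by
  have hb' : -b ≤ b := by linarith
  -- `q` and `f` are extended from `[-b, b]` to continuous functions on the line
  set F : ℝ → ℂ := Set.IccExtend hb' ((Set.Icc (-b) b).domRestrict f) with hF
  set Q : ℝ → ℂ := Set.IccExtend hb' ((Set.Icc (-b) b).domRestrict q) with hQ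
  have hFc : Continuous F := hf.continuousOn.domRestrict.Icc_extend'
  have hQc : Continuous Q := hq.domRestrict.Icc_extend'
  have hFeq : Set.EqOn f F (Set.Icc (-b) b) := fun x hx =>
    (Set.IccExtend_of_mem hb' ((Set.Icc (-b) b).domRestrict f) hx).symm
  have hQeq : Set.EqOn q Q (Set.Icc (-b) b) := fun x hx =>
    (Set.IccExtend_of_mem hb' ((Set.Icc (-b) b).domRestrict q) hx).symm
  have hF0 : ∀ x, F x ≠ 0 := fun x => hf.ne_zero _ (Set.projIcc (-b) b hb' x).2
  have hFsol : IsNonvanishingSolution b Q F := hf.congr hb hQeq hFeq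
  refine ⟨fun K hK n x hx t => ?_, fun u hu hsol ε hε => ?_⟩
  · have hK' : IsTransmutationKernel b Q F K := by
      refine ⟨hK.continuousOn, fun v hv y hy => ?_, fun y hy => ?_⟩
      · rw [← hQeq (Set.Ioo_subset_Icc_self hy)]
        exact hK.intertwines v hv y hy
      · rw [← hFeq hy]; exact hK.map_one y hy
    rw [hK'.volterra_heatPoly hb hFsol hFc hF0 n hx t, transmutedHeatPoly_congr hFeq n hx t]
  · have hsol' : IsSolution b τ Q u := by
      intro x hx t ht
      rw [← hQeq (Set.Ioo_subset_Icc_self hx)]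
      exact hsol x hx t ht
    obtain ⟨N, a, h⟩ := hFsol.exists_approx hb hτ hFc hF0 hQc hu hsol' hε
    refine ⟨N, a, fun x hx t ht => ?_⟩
    simp only [transmutedHeatPoly_congr hFeq _ hx]
    exact h x hx t ht
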